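/- Let $\mathbb T$ be the unit circle, let $|d\zeta|$ be arc length on it, and write $|E|$ for the arc length of a Borel set $E\subset\mathbb T$. For a finite positive Borel measure $\mu$ on $\mathbb T$ and $f\in L^2(\mathbb T)$ put $$\mathcal D_\mu(f)=\int_{\mathbb T}\mathcal D_\xi(f)\,d\mu(\xi),\qquad \mathcal D_\xi(f)=\int_{\mathbb T}\Big|\frac{f(\zeta)-f(\xi)}{\zeta-\xi}\Big|^2\frac{|d\zeta|}{2\pi},$$ where $f(\xi)$ is the non-tangential limit at $\xi$ of the Poisson integral of $f$, and $\mathcal D_\xi(f)=\infty$ if this limit does not exist. Let $\mathcal D^h(\mu)=\{f\in L^2(\mathbb T):\mathcal D_\mu(f)<\infty\}$, with norm $\|f\|_\mu^2=\|f\|_{L^2(\mathbb T,|d\zeta|/2\pi)}^2+\mathcal D_\mu(f)$, and let $\mathcal D(\mu)=\{f\in\mathcal D^h(\mu):\widehat f(n)=0\text{ for all } n<0\}$. The capacity of a set $A\subset\mathbb T$ is $$c_\mu(A)=\inf\{\|f\|_\mu^2: f\in\mathcal D^h(\mu),\ |f|\ge 1\text{ a.e. on a neighborhood of }A\}.$$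 A set $E\subset\mathbb T$ is a uniqueness set for $\mathcal D(\mu)$ if the only $f\in\mathcal D(\mu)$ whose non-tangential limit exists and equals $0$ at every point of $E$ outside a set of zero $c_\mu$-capacity is $f=0$. Finally, let $$V_2(\mu)(\zeta)=\int_{\mathbb T}\frac{d\mu(\xi)}{|\xi-\zeta|^2}\in[0,\infty],\qquad \zeta\in\mathbb T.$$ **Proposition.** Let $(a_n)_{n\ge1}$ be a sequence of positive numbers with $\sum_{n\ge1}a_n=1$, let $\zeta_n\in\mathbb T$ $(n\ge1)$, and let $\mu=\sum_{n\ge1}a_n\delta_{\zeta_n}$. Suppose that $$\int_{\mathbb T}\log V_2(\mu)(\zeta)\,|d\zeta|<\infty.$$ Then a Borel set $E\subset\mathbb T$ is a uniqueness set for $\mathcal D(\mu)$ if and only if $|E|>0$. -/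

import Mathlib

open MeasureTheory Filter Topology
open scoped ENNReal

noncomputable section

/-- The unit circle carries its Borel `σ`-algebra. -/
instance Circle.instMeasurableSpaceBorel : MeasurableSpace Circle := borel Circle

instance Circle.instBorelSpaceBorel : BorelSpace Circle := ⟨rfl⟩

namespace WeightedDirichlet

/-- Arc length `|dζ|` on the unit circle (total mass `2π`). -/
def arcLength : Measure Circle :=
  Measure.map Circle.exp (volume.restrict (Set.Ioc 0 (2 * Real.pi)))

/-- Normalized arc length `|dζ| / 2π`. -/
def m : Measure Circle := ENNReal.ofReal (2 * Real.pi)⁻¹ • arcLength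

/-- `L²(𝕋)`, with respect to normalized arc length. -/
abbrev L2 : Type := Lp ℂ 2 m

/-- The `n`-th Fourier coefficient `∫ f(ζ) ζ⁻ⁿ |dζ|/2π`. -/
def fourierCoefficient (f : L2) (n : ℤ) : ℂ :=
  ∫ ζ : Circle, f ζ * ((ζ ^ (-n) : Circle) : ℂ) ∂m

/-- The Poisson integral of `f` at a point `z` of the open unit disc,
`∫ (1 - |z|²) / |ζ - z|² f(ζ) |dζ|/2π`. For `f ∈ H²` this is the holomorphic function on the disc
which is identified with `f`. -/
def poissonExtension (f : L2) (z : ℂ) : ℂ :=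
  ∫ ζ : Circle, (poissonKernel 0 z (ζ : ℂ) : ℂ) * f ζ ∂m

/-- The nontangential approach region of aperture `α` at the boundary point `ξ`. -/
def approachRegion (α : ℝ) (ξ : Circle) : Set ℂ :=
  {z : ℂ | ‖z‖ < 1 ∧ ‖z - ξ‖ < α * (1 - ‖z‖)}

/-- `c` is the nontangential limit of `f` at `ξ`: the extension of `f` to the disc tends to `c`
inside every nontangential approach region at `ξ`. -/
def HasNTLimit (f : L2) (ξ : Circle) (c : ℂ) : Prop :=
  ∀ α : ℝ, 1 < α → Tendsto (poissonExtension f) (𝓝[approachRegion α ξ] (ξ : ℂ)) (𝓝 c)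

/-- The local Dirichlet integral `∫ |f(ζ) - f(ξ)|² / |ζ - ξ|² |dζ|/2π`, where `f(ξ)` is the
nontangential limit of `f` at `ξ`. The limit is unique when it exists, so that the infimum is over
at most one value; if there is no limit, the local Dirichlet integral is `∞`. (If the integral
`∫ |f(ζ) - c|² / |ζ - ξ|² |dζ|` is finite for some constant `c`, then the nontangential limit exists
and equals `c`.) -/
def localDirichletIntegral (f : L2) (ξ : Circle) : ℝ≥0∞ :=
  ⨅ (c : ℂ) (_ : HasNTLimit f ξ c),
    ∫⁻ ζ : Circle, ENNReal.ofReal (‖(f ζ - c) / ((ζ : ℂ) - (ξ : ℂ))‖ ^ 2) ∂m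

/-- `𝒟_μ(f) = ∫ 𝒟_ξ(f) dμ(ξ)`. -/
def dirichletIntegral (μ : Measure Circle) (f : L2) : ℝ≥0∞ :=
  ∫⁻ ξ : Circle, localDirichletIntegral f ξ ∂μ

/-- The harmonically weighted Dirichlet space `𝒟ʰ(μ)`. -/
def harmonicDirichletSpace (μ : Measure Circle) : Set L2 :=
  {f | dirichletIntegral μ f < ∞}

/-- The analytic weighted Dirichlet space `𝒟(μ)`. -/
def dirichletSpace (μ : Measure Circle) : Set L2 :=
  {f | f ∈ harmonicDirichletSpace μ ∧ ∀ n : ℤ, n < 0 → fourierCoefficient f n = 0}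

/-- The squared norm `‖f‖²_{L²(𝕋)} + 𝒟_μ(f)`. -/
def normSq (μ : Measure Circle) (f : L2) : ℝ≥0∞ :=
  ENNReal.ofReal (‖f‖ ^ 2) + dirichletIntegral μ f

/-- The capacity `c_μ(E)`: the infimum of `‖f‖²_μ` over the `f ∈ 𝒟ʰ(μ)` with `|f| ≥ 1` almost
everywhere on a neighborhood of `E`. -/
def capacity (μ : Measure Circle) (E : Set Circle) : ℝ≥0∞ :=
  ⨅ (f : L2) (_ : f ∈ harmonicDirichletSpace μ ∧
      ∃ U : Set Circle, IsOpen U ∧ E ⊆ U ∧ ∀ᵐ ζ ∂m, ζ ∈ U → 1 ≤ ‖f ζ‖), normSq μ f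

/-- The property `p` holds `c_μ`-quasi-everywhere on `E`. -/
def QuasiEverywhereOn (μ : Measure Circle) (E : Set Circle) (p : Circle → Prop) : Prop :=
  capacity μ {ξ | ξ ∈ E ∧ ¬ p ξ} = 0

/-- `E` is a uniqueness set for `𝒟(μ)`: the only `f ∈ 𝒟(μ)` whose nontangential limit is `0`
`c_μ`-quasi-everywhere on `E` is `f = 0`. -/
def IsUniquenessSet (μ : Measure Circle) (E : Set Circle) : Prop :=
  ∀ f ∈ dirichletSpace μ, QuasiEverywhereOn μ E (fun ξ => HasNTLimit f ξ 0) → f = 0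

/-- The Newtonian potential `V₂(μ)(ζ) = ∫ dμ(ξ) / |ξ - ζ|²`, with values in `[0, ∞]`. -/
def newtonianPotential (μ : Measure Circle) (ζ : Circle) : ℝ≥0∞ :=
  ∫⁻ ξ : Circle, (ENNReal.ofReal (‖(ξ : ℂ) - (ζ : ℂ)‖ ^ 2))⁻¹ ∂μ

/-- The integral `∫ g⁺ - ∫ g⁻` of an extended-real-valued function, meaningful as soon as one of
the two integrals is finite. -/
def extendedIntegral (ν : Measure Circle) (g : Circle → EReal) : EReal :=
  ((∫⁻ ζ, (g ζ).toENNReal ∂ν : ℝ≥0∞) : EReal) - ((∫⁻ ζ, (-g ζ).toENNReal ∂ν : ℝ≥0∞) : EReal)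

/-- The discrete measure `∑ₙ aₙ δ_{ζₙ}`. -/
def discreteMeasure (a : ℕ → ℝ) (z : ℕ → Circle) : Measure Circle :=
  Measure.sum fun n => ENNReal.ofReal (a n) • Measure.dirac (z n)

end WeightedDirichlet

end

/-!
Write `m` for normalized arc length, `P[u]` for the Poisson integral of `u`, and `V` for the
potential `V₂(μ)`.

A set of positive measure is a uniqueness set for every measure `μ`. If `|f| ≥ 1` almost everywhere
on a neighborhood of `A`, then `‖f‖² ≥ m A`; so capacity-null sets are `m`-null
(`measure_le_capacity`), and a function with nontangential limit `0` quasi-everywhere on `E`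
vanishes almost everywhere on `E` (`ae_eq_zero_of_hasNTLimit`), since its dilated Poisson integrals converge
to it in `L¹`. It remains to prove the uniqueness theorem for `H²` (`eq_zero_of_ae_eq_zero_on`). The
product of `P[f]`, which is holomorphic (`differentiableOn_poissonExtension`), with the outer
function of boundary modulus `eⁿ` on `E` and `1` elsewhere has the same boundary modulus as `f`. Hence
`|P[f](w)| exp (n P[1_E](w)) ≤ P[|f|](w)` for all `n`, which forces `P[f](w) = 0`.

Conversely, let `m E = 0`. Choose open sets `U_k ⊇ E` of summable measures and put
`ψ = log (4 V) + ∑ 1_{U_k}`, which is nonnegative, because `V ≥ 1/4`, and integrable, by the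
hypothesis on `V`. The outer function `f` with `|f|² = exp (-ψ)` on the circle satisfies
`|P[f]|² ≤ P[exp (-ψ)]` in the disc, by Jensen's inequality (`exists_outer`). As
`P[|ζ - ξ|²](w) = 2 - 2 Re (w ξ̄)` tends to `0` at `ξ`, so does `P[f]` as soon as `exp (-ψ)` is
dominated by `ε + C |ζ - ξ|²` for every `ε > 0` (`hasNTLimit_zero_of_bound`). This is the case at an
atom `zₙ`, where `exp (-ψ) ≤ (4 V)⁻¹ ≤ |ζ - zₙ|² / (4 aₙ)`, and at every point of `E`, where
`exp (-ψ) ≤ e⁻ᴷ` on the neighborhood `⋂_{k < K} U_k`. So `f` has the limit `0` at every point of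
`E`, its boundary values at the atoms are `0`, and `𝒟_μ(f) ≤ ∫ |f|² V dm < ∞`
(`dirichletIntegral_discreteMeasure_le`): a nonzero element of `𝒟(μ)` vanishing on `E`.
-/

noncomputable section
namespace WeightedDirichlet

/-! ### Arc length and the Poisson kernel -/

instance isFiniteMeasure_arcLength : IsFiniteMeasure arcLength := by
  unfold arcLength; infer_instance

theorem arcLength_univ : arcLength Set.univ = ENNReal.ofReal (2 * Real.pi) := by
  rw [arcLength, Measure.map_apply Circle.exp.continuous.measurable MeasurableSet.univ]
  simp

instance isProbabilityMeasure_m : IsProbabilityMeasure m := by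
  constructor
  rw [m, Measure.smul_apply, arcLength_univ, smul_eq_mul, ← ENNReal.ofReal_mul (by positivity),
    inv_mul_cancel₀ (by positivity), ENNReal.ofReal_one]

theorem ofReal_inv_two_pi_ne_zero : ENNReal.ofReal (2 * Real.pi)⁻¹ ≠ 0 := by
  have : 0 < (2 * Real.pi)⁻¹ := by positivity
  simpa using this

theorem m_eq_zero_iff (A : Set Circle) : m A = 0 ↔ arcLength A = 0 := by
  rw [m, Measure.smul_apply, smul_eq_mul, mul_eq_zero]
  exact or_iff_right ofReal_inv_two_pi_ne_zero

theorem circleMap_eq_exp (θ : ℝ) : circleMap 0 1 θ = (Circle.exp θ : ℂ) := by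
  simp [circleMap]

theorem integral_m_eq_circleAverage {g : ℂ → ℂ}
    (hg : AEStronglyMeasurable (fun ζ : Circle => g ζ) m) :
    ∫ ζ : Circle, g ζ ∂m = Real.circleAverage g 0 1 := by
  have hg' : AEStronglyMeasurable (fun ζ : Circle => g ζ) arcLength :=
    hg.mono_ac (Measure.absolutelyContinuous_smul ofReal_inv_two_pi_ne_zero)
  rw [m, integral_smul_measure, Real.circleAverage_def, arcLength,
    integral_map Circle.exp.continuous.aemeasurable hg',
    intervalIntegral.integral_of_le (by positivity)]
  simp only [circleMap_eq_exp]
  rw [ENNReal.toReal_ofReal (by positivity)]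

theorem circleIntegrable_of_integrable {g : ℂ → ℂ} (hg : Integrable (fun ζ : Circle => g ζ) m) :
    CircleIntegrable g 0 1 := by
  have h1 : Integrable (fun ζ : Circle => g ζ) arcLength :=
    (integrable_smul_measure ofReal_inv_two_pi_ne_zero ENNReal.ofReal_ne_top).1 hg
  rw [CircleIntegrable, intervalIntegrable_iff_integrableOn_Ioc_of_le (by positivity)]
  simp only [circleMap_eq_exp]
  exact h1.comp_measurable Circle.exp.continuous.measurable

theorem integrable_of_continuous {F : Type*} [NormedAddCommGroup F] {u : Circle → F}
    (hu : Continuous u) : Integrable u m :=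
  hu.integrable_of_hasCompactSupport (HasCompactSupport.of_compactSpace _)

theorem coe_sub_ne_zero {z : ℂ} (hz : ‖z‖ < 1) (ζ : Circle) : (ζ : ℂ) - z ≠ 0 := by
  intro h
  rw [← sub_eq_zero.1 h, Circle.norm_coe] at hz
  exact lt_irrefl _ hz

theorem poissonKernel_coe (z : ℂ) (ζ : Circle) :
    poissonKernel 0 z ζ = (1 - ‖z‖ ^ 2) / ‖(ζ : ℂ) - z‖ ^ 2 := by
  simp [poissonKernel_def, Circle.norm_coe]

theorem poissonKernel_pos {z : ℂ} (hz : ‖z‖ < 1) (ζ : Circle) : 0 < poissonKernel 0 z ζ := by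
  rw [poissonKernel_coe]
  have := norm_pos_iff.2 (coe_sub_ne_zero hz ζ)
  have : 0 < 1 - ‖z‖ ^ 2 := by nlinarith [norm_nonneg z]
  positivity

theorem poissonKernel_le {z : ℂ} (hz : ‖z‖ < 1) (ζ : Circle) :
    poissonKernel 0 z ζ ≤ (1 - ‖z‖ ^ 2) / (1 - ‖z‖) ^ 2 := by
  rw [poissonKernel_coe]
  have h1 : 1 - ‖z‖ ≤ ‖(ζ : ℂ) - z‖ := by
    simpa [Circle.norm_coe] using norm_sub_norm_le (ζ : ℂ) z
  have : 0 ≤ 1 - ‖z‖ ^ 2 := by nlinarith [norm_nonneg z]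
  have : 0 < 1 - ‖z‖ := by linarith
  gcongr

theorem continuous_poissonKernel {z : ℂ} (hz : ‖z‖ < 1) :
    Continuous fun ζ : Circle => poissonKernel 0 z ζ := by
  simp only [poissonKernel_coe]
  refine Continuous.div (by fun_prop) (by fun_prop) fun ζ => ?_
  exact pow_ne_zero _ (norm_ne_zero_iff.2 (coe_sub_ne_zero hz ζ))

theorem norm_coe_sub_mul_coe_sq (r : ℝ) (ζ ξ : Circle) :
    ‖(ζ : ℂ) - r * ξ‖ ^ 2
      = 1 + r ^ 2 - 2 * r * ((ζ : ℂ).re * (ξ : ℂ).re + (ζ : ℂ).im * (ξ : ℂ).im) := by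
  have hζ : (ζ : ℂ).re * (ζ : ℂ).re + (ζ : ℂ).im * (ζ : ℂ).im = 1 := by
    rw [← Complex.normSq_apply, Circle.normSq_coe]
  have hξ : (ξ : ℂ).re * (ξ : ℂ).re + (ξ : ℂ).im * (ξ : ℂ).im = 1 := by
    rw [← Complex.normSq_apply, Circle.normSq_coe]
  rw [← Complex.normSq_eq_norm_sq, Complex.normSq_apply]
  simp only [Complex.sub_re, Complex.sub_im, Complex.mul_re, Complex.mul_im, Complex.ofReal_re,
    Complex.ofReal_im]
  linear_combination hζ + r ^ 2 * hξ

theorem poissonKernel_smul_swap (r : ℝ) (ξ ζ : Circle) :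
    poissonKernel 0 (r * ξ) ζ = poissonKernel 0 (r * ζ) ξ := by
  rw [poissonKernel_coe, poissonKernel_coe, norm_coe_sub_mul_coe_sq, norm_coe_sub_mul_coe_sq]
  simp only [norm_mul, Circle.norm_coe]
  ring_nf

theorem integrable_poissonKernel_mul {z : ℂ} (hz : ‖z‖ < 1) {u : Circle → ℝ}
    (hu : Integrable u m) : Integrable (fun ζ : Circle => poissonKernel 0 z ζ * u ζ) m := by
  refine hu.bdd_mul (c := (1 - ‖z‖ ^ 2) / (1 - ‖z‖) ^ 2)
    (continuous_poissonKernel hz).aestronglyMeasurable (ae_of_all _ fun ζ => ?_)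
  rw [Real.norm_of_nonneg (poissonKernel_pos hz ζ).le]
  exact poissonKernel_le hz ζ

theorem integrable_ofReal_poissonKernel_mul {z : ℂ} (hz : ‖z‖ < 1) {u : Circle → ℂ}
    (hu : Integrable u m) : Integrable (fun ζ : Circle => (poissonKernel 0 z ζ : ℂ) * u ζ) m := by
  refine hu.bdd_mul (c := (1 - ‖z‖ ^ 2) / (1 - ‖z‖) ^ 2)
    (Complex.continuous_ofReal.comp (continuous_poissonKernel hz)).aestronglyMeasurable
    (ae_of_all _ fun ζ => ?_)
  rw [Complex.norm_real, Real.norm_of_nonneg (poissonKernel_pos hz ζ).le]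
  exact poissonKernel_le hz ζ

theorem integrable_poissonKernel {z : ℂ} (hz : ‖z‖ < 1) :
    Integrable (fun ζ : Circle => poissonKernel 0 z ζ) m := by
  simpa using integrable_poissonKernel_mul hz (integrable_const (1 : ℝ))

/-- The Poisson integral formula for the unit disc, with respect to normalized arc length. -/
theorem integral_poissonKernel_mul {f : ℂ → ℂ} (hf : DiffContOnCl ℂ f (Metric.ball 0 1)) {w : ℂ}
    (hw : ‖w‖ < 1) : ∫ ζ : Circle, (poissonKernel 0 w ζ : ℂ) * f ζ ∂m = f w := by
  have hfc : Continuous fun ζ : Circle => f ζ := by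
    have := hf.continuousOn
    rw [closure_ball _ one_ne_zero] at this
    exact this.comp_continuous (by fun_prop) (by simp [Circle.norm_coe])
  have hP := continuous_poissonKernel hw
  rw [integral_m_eq_circleAverage (g := fun z => (poissonKernel 0 w z : ℂ) * f z)
    ((Complex.continuous_ofReal.comp hP).mul hfc).aestronglyMeasurable,
    ← hf.circleAverage_poissonKernel_smul (by simpa using hw)]
  rfl

theorem integral_poissonKernel {w : ℂ} (hw : ‖w‖ < 1) :
    ∫ ζ : Circle, poissonKernel 0 w ζ ∂m = 1 := by
  have := integral_poissonKernel_mul (f := fun _ => 1) diffContOnCl_const hw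
  simp only [mul_one] at this
  rw [integral_complex_ofReal] at this
  exact_mod_cast this

/-- `|ζ - ξ|² = 2 - 2 Re (ζ ξ̄)` is the restriction of a harmonic polynomial to the circle. -/
theorem integral_poissonKernel_mul_norm_sub_sq {w : ℂ} (hw : ‖w‖ < 1) (ξ : Circle) :
    ∫ ζ : Circle, poissonKernel 0 w ζ * ‖(ζ : ℂ) - ξ‖ ^ 2 ∂m
      = 2 - 2 * (w * (starRingEnd ℂ) ξ).re := by
  have h1 := integral_poissonKernel_mul (f := fun z => 2 - 2 * (z * (starRingEnd ℂ) (ξ : ℂ)))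
    (Differentiable.diffContOnCl (by fun_prop)) hw
  have h2 := congrArg Complex.re h1
  have hI : Integrable (fun ζ : Circle =>
      (poissonKernel 0 w ζ : ℂ) * (2 - 2 * ((ζ : ℂ) * (starRingEnd ℂ) (ξ : ℂ)))) m := by
    exact integrable_ofReal_poissonKernel_mul hw (integrable_of_continuous (by fun_prop))
  have h3 := integral_re hI
  simp only [RCLike.re_to_complex] at h3
  rw [← h3] at h2
  simp only [Complex.re_ofReal_mul, Complex.sub_re, Complex.re_ofNat] at h2
  have h4 : ∀ ζ : Circle, ‖(ζ : ℂ) - ξ‖ ^ 2 = 2 - (2 * ((ζ : ℂ) * (starRingEnd ℂ) (ξ : ℂ))).re := by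
    intro ζ
    have h5 := norm_coe_sub_mul_coe_sq 1 ζ ξ
    rw [Complex.ofReal_one, one_mul] at h5
    rw [h5]
    simp
    ring
  simp only [h4, h2]
  simp

theorem integrable_exp_neg {ψ : Circle → ℝ} (hψ : Integrable ψ m) (h0 : ∀ ζ, 0 ≤ ψ ζ) :
    Integrable (fun ζ => Real.exp (-ψ ζ)) m := by
  refine Integrable.of_bound (C := 1)
    (Real.continuous_exp.comp_aestronglyMeasurable hψ.aestronglyMeasurable.neg)
    (ae_of_all _ fun ζ => ?_)
  rw [Real.norm_of_nonneg (Real.exp_pos _).le, Real.exp_le_one_iff]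
  linarith [h0 ζ]

/-- Jensen's inequality for the exponential function and a Poisson kernel. -/
theorem exp_neg_integral_poissonKernel_le {w : ℂ} (hw : ‖w‖ < 1) {ψ : Circle → ℝ}
    (hψ : Integrable ψ m) (he : Integrable (fun ζ => Real.exp (-ψ ζ)) m) :
    Real.exp (-∫ ζ : Circle, poissonKernel 0 w ζ * ψ ζ ∂m)
      ≤ ∫ ζ : Circle, poissonKernel 0 w ζ * Real.exp (-ψ ζ) ∂m := by
  set A := ∫ ζ : Circle, poissonKernel 0 w ζ * ψ ζ ∂m with hA
  have hI1 := integrable_poissonKernel_mul hw hψ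
  have hI0 := integrable_poissonKernel hw
  have key : ∫ ζ : Circle, (Real.exp (-A) * (1 + A) * poissonKernel 0 w ζ
      - Real.exp (-A) * (poissonKernel 0 w ζ * ψ ζ)) ∂m = Real.exp (-A) := by
    rw [integral_sub (hI0.const_mul _) (hI1.const_mul _), integral_const_mul, integral_const_mul,
      integral_poissonKernel hw, ← hA]
    ring
  rw [← key]
  refine integral_mono ((hI0.const_mul _).sub (hI1.const_mul _))
    (integrable_poissonKernel_mul hw he) fun ζ => ?_
  -- the graph of `t ↦ exp (-t)` lies above its tangent line at `A`
  have h1 : Real.exp (-A) * (A - ψ ζ + 1) ≤ Real.exp (-ψ ζ) := by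
    have := Real.add_one_le_exp (A - ψ ζ)
    calc _ ≤ Real.exp (-A) * Real.exp (A - ψ ζ) := by gcongr
      _ = _ := by rw [← Real.exp_add]; ring_nf
  have := mul_le_mul_of_nonneg_left h1 (poissonKernel_pos hw ζ).le
  simp only
  linarith

/-! ### Convergence of Poisson integrals -/

/-- The Poisson integral of a function on the circle with respect to normalized arc length. -/
def poissonIntegral (u : Circle → ℂ) (z : ℂ) : ℂ :=
  ∫ ζ : Circle, (poissonKernel 0 z (ζ : ℂ) : ℂ) * u ζ ∂m

theorem norm_ofReal_mul_coe_lt_one {r : ℝ} (hr0 : 0 ≤ r) (hr : r < 1) (ξ : Circle) :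
    ‖(r : ℂ) * ξ‖ < 1 := by
  rwa [norm_mul, Circle.norm_coe, mul_one, Complex.norm_real, Real.norm_of_nonneg hr0]

theorem measurable_poissonKernel_dilate (r : ℝ) :
    Measurable fun p : Circle × Circle => poissonKernel 0 ((r : ℂ) * p.1) (p.2 : ℂ) := by
  have hc : Measurable fun ζ : Circle => (ζ : ℂ) := by fun_prop
  simp only [poissonKernel_coe]
  have h1 : Measurable fun p : Circle × Circle => (p.1 : ℂ) := hc.comp measurable_fst
  have h2 : Measurable fun p : Circle × Circle => (p.2 : ℂ) := hc.comp measurable_snd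
  fun_prop

theorem aestronglyMeasurable_poissonIntegral_dilate {u : Circle → ℂ}
    (hu : AEStronglyMeasurable u m) (r : ℝ) :
    AEStronglyMeasurable (fun ξ : Circle => poissonIntegral u (r * ξ)) m := by
  have h : AEStronglyMeasurable (fun p : Circle × Circle =>
      (poissonKernel 0 ((r : ℂ) * p.1) (p.2 : ℂ) : ℂ) * u p.2) (m.prod m) :=
    (Complex.measurable_ofReal.comp (measurable_poissonKernel_dilate r)).aestronglyMeasurable.mul
      hu.comp_snd
  exact h.integral_prod_right'

/-- Dilated Poisson integrals are contractions of `L¹(𝕋)`, by Fubini's theorem and the symmetry of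
the kernel. -/
theorem lintegral_enorm_poissonIntegral_le {u : Circle → ℂ} (hu : AEStronglyMeasurable u m)
    {r : ℝ} (hr0 : 0 ≤ r) (hr : r < 1) :
    ∫⁻ ξ : Circle, ‖poissonIntegral u (r * ξ)‖ₑ ∂m ≤ ∫⁻ ζ, ‖u ζ‖ₑ ∂m := by
  have hmeas : AEMeasurable (Function.uncurry fun ξ ζ : Circle =>
      ENNReal.ofReal (poissonKernel 0 ((r : ℂ) * ξ) ζ) * ‖u ζ‖ₑ) (m.prod m) :=
    (ENNReal.measurable_ofReal.comp (measurable_poissonKernel_dilate r)).aemeasurable.mul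
      (hu.comp_snd.enorm)
  calc ∫⁻ ξ : Circle, ‖poissonIntegral u (r * ξ)‖ₑ ∂m
      ≤ ∫⁻ ξ : Circle, ∫⁻ ζ : Circle,
          ENNReal.ofReal (poissonKernel 0 ((r : ℂ) * ξ) ζ) * ‖u ζ‖ₑ ∂m ∂m := by
        refine lintegral_mono fun ξ => (enorm_integral_le_lintegral_enorm _).trans_eq ?_
        refine lintegral_congr fun ζ => ?_
        rw [enorm_mul, ← ofReal_norm, Complex.norm_real, Real.norm_of_nonneg
          (poissonKernel_pos (norm_ofReal_mul_coe_lt_one hr0 hr ξ) ζ).le]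
    _ = ∫⁻ ζ : Circle, ∫⁻ ξ : Circle,
          ENNReal.ofReal (poissonKernel 0 ((r : ℂ) * ξ) ζ) * ‖u ζ‖ₑ ∂m ∂m :=
        lintegral_lintegral_swap hmeas
    _ = ∫⁻ ζ, ‖u ζ‖ₑ ∂m := by
        refine lintegral_congr fun ζ => ?_
        have hz := norm_ofReal_mul_coe_lt_one hr0 hr ζ
        simp only [poissonKernel_smul_swap r _ ζ]
        have hm : Measurable fun ξ : Circle => ENNReal.ofReal (poissonKernel 0 ((r : ℂ) * ζ) ξ) :=
          ENNReal.measurable_ofReal.comp (continuous_poissonKernel hz).measurable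
        rw [lintegral_mul_const _ hm, ← ofReal_integral_eq_lintegral_ofReal
            (integrable_poissonKernel hz)
            (ae_of_all _ fun ξ => (poissonKernel_pos hz ξ).le),
          integral_poissonKernel hz, ENNReal.ofReal_one, one_mul]

theorem poissonIntegral_sub {u v : Circle → ℂ} (hu : Integrable u m) (hv : Integrable v m) {z : ℂ}
    (hz : ‖z‖ < 1) :
    poissonIntegral (fun ζ => u ζ - v ζ) z = poissonIntegral u z - poissonIntegral v z := by
  simp only [poissonIntegral, mul_sub]
  exact integral_sub (integrable_ofReal_poissonKernel_mul hz hu)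
    (integrable_ofReal_poissonKernel_mul hz hv)

theorem poissonIntegral_const (c : ℂ) {z : ℂ} (hz : ‖z‖ < 1) :
    poissonIntegral (fun _ => c) z = c :=
  integral_poissonKernel_mul (f := fun _ => c) diffContOnCl_const hz

theorem norm_poissonIntegral_le {u : Circle → ℂ} {z : ℂ} (hz : ‖z‖ < 1) :
    ‖poissonIntegral u z‖ ≤ ∫ ζ : Circle, poissonKernel 0 z ζ * ‖u ζ‖ ∂m := by
  refine (norm_integral_le_integral_norm _).trans_eq (integral_congr_ae (ae_of_all _ fun ζ => ?_))
  simp only [norm_mul, Complex.norm_real, Real.norm_of_nonneg (poissonKernel_pos hz ζ).le]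

theorem integral_poissonKernel_mul_quadratic {z : ℂ} (hz : ‖z‖ < 1) (ξ : Circle) (ε C : ℝ) :
    ∫ ζ : Circle, poissonKernel 0 z ζ * (ε + C * ‖(ζ : ℂ) - ξ‖ ^ 2) ∂m
      = ε + C * (2 - 2 * (z * (starRingEnd ℂ) ξ).re) := by
  have hI : Integrable (fun ζ : Circle => poissonKernel 0 z ζ * ‖(ζ : ℂ) - ξ‖ ^ 2) m :=
    integrable_poissonKernel_mul hz (integrable_of_continuous (by fun_prop))
  have h0 := integrable_poissonKernel hz
  rw [← integral_poissonKernel_mul_norm_sub_sq hz ξ, ← integral_const_mul]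
  calc _ = ∫ ζ : Circle, (poissonKernel 0 z ζ * ε
        + C * (poissonKernel 0 z ζ * ‖(ζ : ℂ) - ξ‖ ^ 2)) ∂m := by
        congr 1; ext ζ; ring
    _ = _ := by
      rw [integral_add (h0.mul_const _) (hI.const_mul _), integral_mul_const,
        integral_poissonKernel hz, one_mul]

/-- Uniform continuity in a form suited to the Poisson kernel, whose integral against
`|ζ - ξ|²` is explicit. -/
theorem exists_norm_sub_le_of_continuous {g : Circle → ℂ} (hg : Continuous g) {ε : ℝ}
    (hε : 0 < ε) : ∃ C : ℝ, 0 ≤ C ∧ ∀ ζ ξ : Circle, ‖g ζ - g ξ‖ ≤ ε + C * ‖(ζ : ℂ) - ξ‖ ^ 2 := by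
  obtain ⟨δ, hδ, h⟩ := Metric.uniformContinuous_iff.1
    (CompactSpace.uniformContinuous_of_continuous hg) ε hε
  obtain ⟨M, hM⟩ := (isCompact_range hg).isBounded.exists_norm_le
  have hM0 : 0 ≤ M := (norm_nonneg _).trans (hM (g 1) ⟨1, rfl⟩)
  refine ⟨2 * M / δ ^ 2, by positivity, fun ζ ξ => ?_⟩
  by_cases hd : dist ζ ξ < δ
  · have := h hd
    rw [dist_eq_norm] at this
    have : 0 ≤ 2 * M / δ ^ 2 * ‖(ζ : ℂ) - ξ‖ ^ 2 := by positivity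
    linarith
  · have h1 : δ ≤ ‖(ζ : ℂ) - ξ‖ := by
      rw [← dist_eq_norm]; exact not_lt.1 hd
    have h2 : ‖g ζ - g ξ‖ ≤ 2 * M := by
      have := norm_sub_le (g ζ) (g ξ)
      linarith [hM (g ζ) ⟨ζ, rfl⟩, hM (g ξ) ⟨ξ, rfl⟩]
    have h3 : 2 * M ≤ 2 * M / δ ^ 2 * ‖(ζ : ℂ) - ξ‖ ^ 2 := by
      calc 2 * M = 2 * M / δ ^ 2 * δ ^ 2 := by field_simp
        _ ≤ _ := by gcongr
    linarith

theorem norm_poissonIntegral_sub_le {g : Circle → ℂ} (hg : Continuous g) {ε C : ℝ}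
    (h : ∀ ζ ξ : Circle, ‖g ζ - g ξ‖ ≤ ε + C * ‖(ζ : ℂ) - ξ‖ ^ 2) {r : ℝ} (hr0 : 0 ≤ r)
    (hr : r < 1) (ξ : Circle) : ‖poissonIntegral g (r * ξ) - g ξ‖ ≤ ε + C * (2 - 2 * r) := by
  have hz := norm_ofReal_mul_coe_lt_one hr0 hr ξ
  rw [← poissonIntegral_const (g ξ) hz,
    ← poissonIntegral_sub (integrable_of_continuous hg) (integrable_const _) hz]
  refine (norm_poissonIntegral_le hz).trans ?_
  have h1 : ((r : ℂ) * ξ * (starRingEnd ℂ) (ξ : ℂ)).re = r := by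
    rw [mul_assoc, Complex.mul_conj, Circle.normSq_coe]; simp
  have h2 := integral_poissonKernel_mul_quadratic hz ξ ε C
  rw [h1] at h2
  rw [← h2]
  have hgi : Integrable (fun ζ => g ζ - g ξ) m := integrable_of_continuous (by fun_prop)
  refine integral_mono
    (integrable_poissonKernel_mul hz hgi.norm)
    (integrable_poissonKernel_mul hz (integrable_of_continuous (by fun_prop))) fun ζ => ?_
  exact mul_le_mul_of_nonneg_left (h ζ ξ) (poissonKernel_pos hz ζ).le

theorem eventually_mem_Ioo_one : ∀ᶠ r : ℝ in 𝓝[<] 1, 0 < r ∧ r < 1 :=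
  Ioo_mem_nhdsLT zero_lt_one

/-- The dilated Poisson integrals of an integrable function converge to it in `L¹(𝕋)`. -/
theorem tendsto_lintegral_enorm_poissonIntegral_sub {u : Circle → ℂ} (hu : Integrable u m) :
    Tendsto (fun r : ℝ => ∫⁻ ξ : Circle, ‖poissonIntegral u (r * ξ) - u ξ‖ₑ ∂m) (𝓝[<] 1)
      (𝓝 0) := by
  have aux : ∀ ε : ℝ, 0 < ε → ∀ᶠ r : ℝ in 𝓝[<] 1,
      ∫⁻ ξ : Circle, ‖poissonIntegral u (r * ξ) - u ξ‖ₑ ∂m ≤ ENNReal.ofReal (4 * ε) := by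
    intro ε hε
    obtain ⟨g, hg, hgi⟩ := hu.exists_boundedContinuous_lintegral_sub_le
      (ε := ENNReal.ofReal ε) (by simpa using hε)
    obtain ⟨C, hC, hgC⟩ := exists_norm_sub_le_of_continuous g.continuous hε
    have hlim : Tendsto (fun r : ℝ => C * (2 - 2 * r)) (𝓝[<] 1) (𝓝 0) := by
      have : Tendsto (fun r : ℝ => C * (2 - 2 * r)) (𝓝 1) (𝓝 (C * (2 - 2 * 1))) :=
        Continuous.tendsto (by fun_prop) _
      simpa using this.mono_left nhdsWithin_le_nhds
    filter_upwards [eventually_mem_Ioo_one, hlim.eventually_lt_const hε] with r hr hrC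
    have hug : Integrable (fun ζ => u ζ - g ζ) m := hu.sub hgi
    have hpt : ∀ ξ : Circle, ‖poissonIntegral u (r * ξ) - u ξ‖ₑ
        ≤ ‖poissonIntegral (fun ζ => u ζ - g ζ) (r * ξ)‖ₑ + ENNReal.ofReal (2 * ε)
          + ‖u ξ - g ξ‖ₑ := by
      intro ξ
      have hz := norm_ofReal_mul_coe_lt_one hr.1.le hr.2 ξ
      have h1 : poissonIntegral u (r * ξ) - u ξ
          = poissonIntegral (fun ζ => u ζ - g ζ) (r * ξ) + (poissonIntegral g (r * ξ) - g ξ)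
            - (u ξ - g ξ) := by
        rw [poissonIntegral_sub hu hgi hz]; ring
      rw [h1]
      refine (enorm_sub_le).trans (add_le_add ((enorm_add_le _ _).trans
        (add_le_add le_rfl ?_)) le_rfl)
      rw [← ofReal_norm]
      refine ENNReal.ofReal_le_ofReal ?_
      have := norm_poissonIntegral_sub_le g.continuous hgC hr.1.le hr.2 ξ
      linarith
    have hmeas : AEMeasurable (fun ξ : Circle => ‖u ξ - g ξ‖ₑ) m :=
      hug.aestronglyMeasurable.enorm
    calc _ ≤ ∫⁻ ξ : Circle, (‖poissonIntegral (fun ζ => u ζ - g ζ) (r * ξ)‖ₑ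
          + ENNReal.ofReal (2 * ε) + ‖u ξ - g ξ‖ₑ) ∂m := lintegral_mono hpt
      _ = ∫⁻ ξ : Circle, ‖poissonIntegral (fun ζ => u ζ - g ζ) (r * ξ)‖ₑ ∂m
          + ENNReal.ofReal (2 * ε) + ∫⁻ ξ : Circle, ‖u ξ - g ξ‖ₑ ∂m := by
          rw [lintegral_add_right' _ hmeas, lintegral_add_right _ measurable_const,
            lintegral_const, measure_univ, mul_one]
      _ ≤ ENNReal.ofReal ε + ENNReal.ofReal (2 * ε) + ENNReal.ofReal ε := by
          gcongr
          exact (lintegral_enorm_poissonIntegral_le hug.aestronglyMeasurable hr.1.le hr.2).trans hg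
      _ = ENNReal.ofReal (4 * ε) := by
          rw [← ENNReal.ofReal_add hε.le (by positivity),
            ← ENNReal.ofReal_add (by positivity) hε.le]
          congr 1; ring
  refine ENNReal.tendsto_nhds_zero.2 fun ε hε => ?_
  obtain ⟨q, hq0, hq⟩ := ENNReal.lt_iff_exists_nnreal_btwn.1 hε
  have hq0' : (0 : ℝ) < q := by exact_mod_cast hq0
  filter_upwards [aux (q / 4) (by positivity)] with r hr
  refine hr.trans (le_trans ?_ hq.le)
  rw [mul_div_cancel₀ _ (by norm_num : (4 : ℝ) ≠ 0), ENNReal.ofReal_coe_nnreal]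

/-- Along a common sequence of radii, the dilated Poisson integrals of two integrable functions
converge almost everywhere. -/
theorem exists_seq_tendsto_poissonIntegral {u v : Circle → ℂ} (hu : Integrable u m)
    (hv : Integrable v m) :
    ∃ r : ℕ → ℝ, (∀ k, 0 < r k ∧ r k < 1) ∧ Tendsto r atTop (𝓝[<] 1) ∧
      (∀ᵐ ξ : Circle ∂m, Tendsto (fun k => poissonIntegral u (r k * ξ)) atTop (𝓝 (u ξ))) ∧
      ∀ᵐ ξ : Circle ∂m, Tendsto (fun k => poissonIntegral v (r k * ξ)) atTop (𝓝 (v ξ)) := by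
  have hmeas : ∀ {w : Circle → ℂ}, Integrable w m → TendstoInMeasure m
      (fun (r : ℝ) (ξ : Circle) => poissonIntegral w (r * ξ)) (𝓝[<] 1) w := by
    intro w hw
    refine tendstoInMeasure_of_tendsto_eLpNorm one_ne_zero
      (fun r => aestronglyMeasurable_poissonIntegral_dilate hw.aestronglyMeasurable r)
      hw.aestronglyMeasurable ?_
    simp only [eLpNorm_one_eq_lintegral_enorm, Pi.sub_apply]
    exact tendsto_lintegral_enorm_poissonIntegral_sub hw
  obtain ⟨s, hs, hsu⟩ := (hmeas hu).exists_seq_tendsto_ae'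
  have hvs : TendstoInMeasure m (fun k (ξ : Circle) => poissonIntegral v (s k * ξ)) atTop v :=
    fun ε hε => (hmeas hv ε hε).comp hs
  obtain ⟨t, ht, htv⟩ := hvs.exists_seq_tendsto_ae
  have hst := hs.comp ht.tendsto_atTop
  obtain ⟨N, hN⟩ := eventually_atTop.1 (hst.eventually eventually_mem_Ioo_one)
  refine ⟨fun k => s (t (k + N)), fun k => hN _ (by omega),
    hst.comp (tendsto_add_atTop_nat N), ?_, ?_⟩
  · filter_upwards [hsu] with ξ hξ
    exact (hξ.comp ht.tendsto_atTop).comp (tendsto_add_atTop_nat N)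
  · filter_upwards [htv] with ξ hξ
    exact hξ.comp (tendsto_add_atTop_nat N)

/-! ### Outer functions and their boundary values -/

theorem integrable_coe_L2 (f : L2) : Integrable (fun ζ => f ζ) m :=
  (Lp.memLp f).integrable (by norm_num)

theorem poissonExtension_zero (z : ℂ) : poissonExtension (0 : L2) z = 0 := by
  rw [poissonExtension]
  refine integral_eq_zero_of_ae ?_
  filter_upwards [Lp.coeFn_zero ℂ 2 m] with ζ hζ
  rw [hζ]; simp

/-- A function on the circle, extended by `0` to the plane. -/
def extendCircle (u : Circle → ℂ) : ℂ → ℂ := Function.extend (fun ζ : Circle => (ζ : ℂ)) u 0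

theorem extendCircle_coe (u : Circle → ℂ) (ζ : Circle) : extendCircle u ζ = u ζ :=
  Circle.coe_injective.extend_apply u 0 ζ

/-- The Herglotz integral `∫ (ζ + z) / (ζ - z) u(ζ) |dζ|/2π`. -/
def herglotzIntegral (u : Circle → ℂ) (z : ℂ) : ℂ :=
  ∫ ζ : Circle, herglotzRieszKernel 0 z (ζ : ℂ) * u ζ ∂m

theorem continuous_herglotzRieszKernel {z : ℂ} (hz : ‖z‖ < 1) :
    Continuous fun ζ : Circle => herglotzRieszKernel 0 z ζ := by
  simp only [herglotzRieszKernel_def, sub_zero]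
  exact Continuous.div (by fun_prop) (by fun_prop) (coe_sub_ne_zero hz)

theorem integrable_herglotzRieszKernel_mul {z : ℂ} (hz : ‖z‖ < 1) {u : Circle → ℂ}
    (hu : Integrable u m) : Integrable (fun ζ : Circle => herglotzRieszKernel 0 z ζ * u ζ) m := by
  obtain ⟨C, hC⟩ := (isCompact_range (continuous_herglotzRieszKernel hz)).isBounded.exists_norm_le
  exact hu.bdd_mul (continuous_herglotzRieszKernel hz).aestronglyMeasurable
    (ae_of_all _ fun ζ => hC _ ⟨ζ, rfl⟩)

theorem differentiableOn_herglotzIntegral {u : Circle → ℂ} (hu : Integrable u m) :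
    DifferentiableOn ℂ (herglotzIntegral u) (Metric.ball 0 1) := by
  have hu' : Integrable (fun ζ : Circle => extendCircle u ζ) m := by
    simpa only [extendCircle_coe] using hu
  refine (differentiableOn_circleAverage_herglotzRieszKernel_smul
    (circleIntegrable_of_integrable hu')).congr fun z hz => ?_
  have hz' : ‖z‖ < 1 := by simpa using hz
  have hI := (integrable_herglotzRieszKernel_mul hz' hu').aestronglyMeasurable
  simp only [smul_eq_mul]
  rw [← integral_m_eq_circleAverage (g := fun ζ => herglotzRieszKernel 0 z ζ * extendCircle u ζ) hI]
  simp only [extendCircle_coe, herglotzIntegral]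

theorem re_herglotzIntegral_ofReal {φ : Circle → ℝ} (hφ : Integrable φ m) {z : ℂ} (hz : ‖z‖ < 1) :
    (herglotzIntegral (fun ζ => (φ ζ : ℂ)) z).re = ∫ ζ : Circle, poissonKernel 0 z ζ * φ ζ ∂m := by
  have h := integral_re (integrable_herglotzRieszKernel_mul hz hφ.ofReal)
  simp only [RCLike.re_to_complex] at h
  rw [herglotzIntegral]
  refine h.symm.trans (integral_congr_ae (ae_of_all _ fun ζ => ?_))
  simp [poissonKernel_eq_re_herglotzRieszKernel]

/-- For every real `φ ∈ L¹(𝕋)` there is an outer function with modulus `exp (-P[φ])`. -/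
theorem exists_holomorphic_norm_eq_exp_neg {φ : Circle → ℝ} (hφ : Integrable φ m) :
    ∃ G : ℂ → ℂ, DifferentiableOn ℂ G (Metric.ball 0 1) ∧
      ∀ z : ℂ, ‖z‖ < 1 → ‖G z‖ = Real.exp (-∫ ζ : Circle, poissonKernel 0 z ζ * φ ζ ∂m) := by
  refine ⟨fun z => Complex.exp (-herglotzIntegral (fun ζ => (φ ζ : ℂ)) z),
    (differentiableOn_herglotzIntegral hφ.ofReal).neg.cexp, fun z hz => ?_⟩
  rw [Complex.norm_exp, Complex.neg_re, re_herglotzIntegral_ofReal hφ hz]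

theorem diffContOnCl_dilate {G : ℂ → ℂ} (hG : DifferentiableOn ℂ G (Metric.ball 0 1)) {r : ℝ}
    (hr0 : 0 ≤ r) (hr : r < 1) :
    DiffContOnCl ℂ (fun z => G (r * z)) (Metric.ball 0 1) := by
  refine DifferentiableOn.diffContOnCl (hG.comp (by fun_prop) fun z hz => ?_)
  rw [closure_ball _ one_ne_zero, mem_closedBall_zero_iff] at hz
  rw [mem_ball_zero_iff, norm_mul, Complex.norm_real, Real.norm_of_nonneg hr0]
  nlinarith [norm_nonneg z]

theorem memLp_of_continuous {u : Circle → ℂ} (hu : Continuous u) : MemLp u 2 m :=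
  hu.memLp_of_hasCompactSupport (HasCompactSupport.of_compactSpace _)

theorem continuous_coe_circle_dilate {G : ℂ → ℂ} (hG : DifferentiableOn ℂ G (Metric.ball 0 1))
    {r : ℝ} (hr0 : 0 ≤ r) (hr : r < 1) : Continuous fun ζ : Circle => G (r * ζ) := by
  refine hG.continuousOn.comp_continuous (by fun_prop) fun ζ => ?_
  simpa using norm_ofReal_mul_coe_lt_one hr0 hr ζ

theorem integral_dilate_mul_zpow {G : ℂ → ℂ} (hG : DifferentiableOn ℂ G (Metric.ball 0 1))
    {r : ℝ} (hr0 : 0 ≤ r) (hr : r < 1) {n : ℤ} (hn : n < 0) :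
    ∫ ζ : Circle, G (r * ζ) * ((ζ ^ (-n) : Circle) : ℂ) ∂m = 0 := by
  obtain ⟨k, rfl⟩ : ∃ k : ℕ, n = -((k : ℤ) + 1) := ⟨(-n - 1).toNat, by omega⟩
  have h := integral_poissonKernel_mul (w := 0)
    ((diffContOnCl_dilate hG hr0 hr).smul
      (Differentiable.diffContOnCl (f := fun z : ℂ => z ^ (k + 1)) (by fun_prop))) (by simp)
  simp only [smul_eq_mul, poissonKernel_coe] at h
  have hk : -(-((k : ℤ) + 1)) = ((k + 1 : ℕ) : ℤ) := by push_cast; ring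
  rw [hk]
  simp only [zpow_natCast, Circle.coe_pow]
  simpa [Circle.norm_coe] using h

/-- A holomorphic function on the disc bounded by `1` is the Poisson integral of a function in
`L²(𝕋)` with vanishing negative Fourier coefficients: a weak limit of the dilations. -/
theorem exists_poissonExtension_eq {G : ℂ → ℂ} (hG : DifferentiableOn ℂ G (Metric.ball 0 1))
    (hb : ∀ z : ℂ, ‖z‖ < 1 → ‖G z‖ ≤ 1) :
    ∃ f : L2, (∀ z : ℂ, ‖z‖ < 1 → poissonExtension f z = G z) ∧
      ∀ n : ℤ, n < 0 → fourierCoefficient f n = 0 := by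
  -- radii increasing to `1`, starting from `1 / 2`
  set r : ℕ → ℝ := fun k => 1 - 1 / ((k : ℝ) + 2) with hr
  have hr01 : ∀ k, 0 ≤ r k ∧ r k < 1 := by
    intro k
    have h2 : (2 : ℝ) ≤ (k : ℝ) + 2 := by simp
    have : 1 / ((k : ℝ) + 2) ≤ 1 := by
      rw [div_le_one (by positivity)]; linarith
    have : 0 < 1 / ((k : ℝ) + 2) := by positivity
    constructor <;> simp only [hr] <;> linarith
  have hrlim : Tendsto r atTop (𝓝 1) := by
    have h1 : Tendsto (fun k : ℕ => 1 / ((k : ℝ) + 2)) atTop (𝓝 0) :=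
      tendsto_const_nhds.div_atTop
        (tendsto_atTop_add_const_right _ _ tendsto_natCast_atTop_atTop)
    simpa only [hr, sub_zero] using h1.const_sub 1
  set F : ℕ → L2 := fun k =>
    (memLp_of_continuous (continuous_coe_circle_dilate hG (hr01 k).1 (hr01 k).2)).toLp _ with hF
  have hFcoe : ∀ k, F k =ᵐ[m] fun ζ : Circle => G (r k * ζ) := fun k => MemLp.coeFn_toLp _
  have hFnorm : ∀ k, ‖F k‖ ≤ 1 := by
    intro k
    have := Lp.norm_le_of_ae_bound (f := F k) (C := 1) zero_le_one (by
      filter_upwards [hFcoe k] with ζ hζ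
      rw [hζ]
      exact hb _ (norm_ofReal_mul_coe_lt_one (hr01 k).1 (hr01 k).2 ζ))
    simpa [measureUnivNNReal] using this
  set T : ℕ → WeakDual ℂ L2 := fun k => StrongDual.toWeakDual (innerSL ℂ (F k)) with hT
  obtain ⟨ℓ, -, hℓ⟩ := (WeakDual.isCompact_closedBall (𝕜 := ℂ) (E := L2) 0 1).ultrafilter_le_nhds
    ((hyperfilter ℕ : Ultrafilter ℕ).map T) (by
      rw [le_principal_iff]
      refine Filter.mem_map.2 (Filter.mem_of_superset Filter.univ_mem fun k _ => ?_)
      simpa [hT] using hFnorm k)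
  have hev : ∀ g : L2, Tendsto (fun k => inner ℂ (F k) g) (hyperfilter ℕ : Filter ℕ) (𝓝 (ℓ g)) := by
    intro g
    exact ((WeakDual.eval_continuous g).tendsto ℓ).comp hℓ
  set f : L2 := (InnerProductSpace.toDual ℂ L2).symm (WeakDual.toStrongDual ℓ) with hf
  have hinner : ∀ g : L2, inner ℂ f g = ℓ g := fun g => by
    rw [hf, InnerProductSpace.toDual_symm_apply]; rfl
  -- weak convergence tested against continuous functions
  have hweak : ∀ g : Circle → ℂ, Continuous g →
      Tendsto (fun k => ∫ ζ : Circle, G (r k * ζ) * g ζ ∂m) (hyperfilter ℕ : Filter ℕ)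
        (𝓝 (∫ ζ : Circle, f ζ * g ζ ∂m)) := by
    intro g hg
    have hgc : Continuous fun ζ => (starRingEnd ℂ) (g ζ) := by fun_prop
    set g' : L2 := (memLp_of_continuous hgc).toLp _ with hg'
    have hg'c : g' =ᵐ[m] fun ζ => (starRingEnd ℂ) (g ζ) := MemLp.coeFn_toLp _
    have hI : ∀ h : L2, inner ℂ g' h = ∫ ζ : Circle, h ζ * g ζ ∂m := by
      intro h
      rw [L2.inner_def]
      refine integral_congr_ae ?_
      filter_upwards [hg'c] with ζ hζ
      rw [hζ]; simp
    have h1 := (Complex.continuous_conj.tendsto _).comp (hev g')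
    rw [← hinner, inner_conj_symm, hI] at h1
    refine h1.congr fun k => ?_
    simp only [Function.comp_apply]
    rw [inner_conj_symm, hI]
    refine integral_congr_ae ?_
    filter_upwards [hFcoe k] with ζ hζ
    rw [hζ]
  refine ⟨f, fun z hz => ?_, fun n hn => ?_⟩
  · have h1 := hweak (fun ζ => (poissonKernel 0 z ζ : ℂ))
      (Complex.continuous_ofReal.comp (continuous_poissonKernel hz))
    have h2 : Tendsto (fun k => G (r k * z)) (hyperfilter ℕ : Filter ℕ) (𝓝 (G z)) := by
      have hc : ContinuousAt G z :=
        (hG.continuousOn).continuousAt (Metric.isOpen_ball.mem_nhds (by simpa using hz))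
      have h3 : Tendsto (fun k => (r k : ℂ) * z) atTop (𝓝 z) := by
        simpa using ((Complex.continuous_ofReal.tendsto _).comp hrlim).mul_const z
      exact (hc.tendsto.comp h3).mono_left Nat.hyperfilter_le_atTop
    have h4 : ∀ k, ∫ ζ : Circle, G (r k * ζ) * (poissonKernel 0 z ζ : ℂ) ∂m = G (r k * z) := by
      intro k
      rw [← integral_poissonKernel_mul (diffContOnCl_dilate hG (hr01 k).1 (hr01 k).2) hz]
      simp only [mul_comm]
    simp only [h4] at h1
    rw [tendsto_nhds_unique h2 h1, poissonExtension]
    simp only [mul_comm]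
  · have h1 := hweak (fun ζ => ((ζ ^ (-n) : Circle) : ℂ))
      (Continuous.comp (g := fun ζ : Circle => (ζ : ℂ)) (by fun_prop) (continuous_zpow (-n)))
    simp only [integral_dilate_mul_zpow hG (hr01 _).1 (hr01 _).2 hn] at h1
    exact tendsto_nhds_unique h1 tendsto_const_nhds

/-- The boundary function of an outer function: for integrable `ψ ≥ 0` there is a nonzero `f ∈ H²`
with `|f|² ≤ exp (-ψ)` almost everywhere, and such that the same bound holds in the disc for the
Poisson integrals. -/
theorem exists_outer {ψ : Circle → ℝ} (hψ : Integrable ψ m) (h0 : ∀ ζ, 0 ≤ ψ ζ) :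
    ∃ f : L2, f ≠ 0 ∧ (∀ n : ℤ, n < 0 → fourierCoefficient f n = 0) ∧
      (∀ z : ℂ, ‖z‖ < 1 → ‖poissonExtension f z‖ ^ 2
        ≤ ∫ ζ : Circle, poissonKernel 0 z ζ * Real.exp (-ψ ζ) ∂m) ∧
      ∀ᵐ ζ ∂m, ‖f ζ‖ ^ 2 ≤ Real.exp (-ψ ζ) := by
  -- the factor `1 / 2` gives `|G|² = exp (-P[ψ])`
  obtain ⟨G, hG, hGn⟩ := exists_holomorphic_norm_eq_exp_neg (hψ.div_const 2)
  have he := integrable_exp_neg hψ h0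
  have hb : ∀ z : ℂ, ‖z‖ < 1 → ‖G z‖ ≤ 1 := by
    intro z hz
    rw [hGn z hz, Real.exp_le_one_iff, neg_nonpos]
    refine integral_nonneg fun ζ => mul_nonneg (poissonKernel_pos hz ζ).le ?_
    have := h0 ζ
    positivity
  have hsq : ∀ z : ℂ, ‖z‖ < 1 →
      ‖G z‖ ^ 2 ≤ ∫ ζ : Circle, poissonKernel 0 z ζ * Real.exp (-ψ ζ) ∂m := by
    intro z hz
    refine le_trans (le_of_eq ?_) (exp_neg_integral_poissonKernel_le hz hψ he)
    rw [hGn z hz, ← Real.exp_nat_mul]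
    simp only [← mul_div_assoc]
    rw [integral_div]
    congr 1
    push_cast
    ring
  obtain ⟨f, hf, hfc⟩ := exists_poissonExtension_eq hG hb
  refine ⟨f, ?_, hfc, fun z hz => by rw [hf z hz]; exact hsq z hz, ?_⟩
  · rintro rfl
    have h1 := hf 0 (by simp)
    have h3 := hGn 0 (by simp)
    rw [← h1, poissonExtension_zero, norm_zero] at h3
    exact (Real.exp_pos _).ne h3
  · obtain ⟨r, hr, -, h1, h2⟩ := exists_seq_tendsto_poissonIntegral (integrable_coe_L2 f)
      (he.ofReal (𝕜 := ℂ))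
    -- the bound in the disc passes to the boundary along a sequence of radii
    filter_upwards [h1, h2] with ξ hξ1 hξ2
    have h5 : Tendsto (fun k => (poissonIntegral (fun ζ => ((Real.exp (-ψ ζ) : ℝ) : ℂ))
        (r k * ξ)).re) atTop (𝓝 (Real.exp (-ψ ξ))) :=
      (Complex.continuous_re.tendsto ((Real.exp (-ψ ξ) : ℝ) : ℂ)).comp hξ2
    refine le_of_tendsto_of_tendsto' (hξ1.norm.pow 2) h5 fun k => ?_
    have hz := norm_ofReal_mul_coe_lt_one (hr k).1.le (hr k).2 ξ
    have h3 : poissonIntegral (fun ζ => ((Real.exp (-ψ ζ) : ℝ) : ℂ)) (r k * ξ)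
        = ((∫ ζ : Circle, poissonKernel 0 (r k * ξ) ζ * Real.exp (-ψ ζ) ∂m : ℝ) : ℂ) := by
      rw [poissonIntegral, ← integral_complex_ofReal]
      simp only [Complex.ofReal_mul]
    have h4 : poissonIntegral (fun ζ => f ζ) (r k * ξ) = G (r k * ξ) := hf _ hz
    rw [h4]
    refine (hsq _ hz).trans_eq ?_
    exact (congrArg Complex.re h3).symm

/-! ### The uniqueness theorem for the Hardy space -/

theorem integral_mul_pow_eq_zero {f : L2} (hf : ∀ n : ℤ, n < 0 → fourierCoefficient f n = 0)
    (n : ℕ) : ∫ ζ : Circle, f ζ * (ζ : ℂ) ^ (n + 1) ∂m = 0 := by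
  have h := hf (-((n + 1 : ℕ) : ℤ)) (by omega)
  simpa only [fourierCoefficient, neg_neg, zpow_natCast, Circle.coe_pow] using h

/-- The conjugate Herglotz kernel is `1 + 2 ∑ (z̄ ζ)ⁿ`, summed over `n ≥ 1`, so that only the
constant term survives against a function in `H²`. -/
theorem integral_conj_herglotzRieszKernel_mul {f : L2}
    (hf : ∀ n : ℤ, n < 0 → fourierCoefficient f n = 0) {z : ℂ} (hz : ‖z‖ < 1) :
    ∫ ζ : Circle, (starRingEnd ℂ) (herglotzRieszKernel 0 z ζ) * f ζ ∂m = ∫ ζ, f ζ ∂m := by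
  have hfi := integrable_coe_L2 f
  set w := (starRingEnd ℂ) z with hw
  have hwn : ‖w‖ < 1 := by rwa [hw, RCLike.norm_conj]
  set F : ℕ → Circle → ℂ := fun n ζ => 2 * w ^ (n + 1) * (f ζ * (ζ : ℂ) ^ (n + 1)) with hF
  have hmul : ∀ n : ℕ, Integrable (fun ζ : Circle => f ζ * (ζ : ℂ) ^ (n + 1)) m := fun n =>
    hfi.mul_bdd (c := 1) (Continuous.aestronglyMeasurable (by fun_prop))
      (ae_of_all _ fun ζ => by simp [Circle.norm_coe])
  have hFi : ∀ n, Integrable (F n) m := fun n => (hmul n).const_mul _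
  have hFn : ∀ n, ∫ ζ, ‖F n ζ‖ ∂m = 2 * (∫ ζ, ‖f ζ‖ ∂m) * ‖w‖ * ‖w‖ ^ n := by
    intro n
    simp only [hF, norm_mul, norm_pow, Circle.norm_coe, one_pow, mul_one]
    rw [integral_const_mul]
    simp only [Complex.norm_ofNat]
    ring
  have hsum : Summable fun n => ∫ ζ, ‖F n ζ‖ ∂m := by
    simp only [hFn]
    exact (summable_geometric_of_lt_one (norm_nonneg w) hwn).mul_left _
  have h1 := hasSum_integral_of_summable_integral_norm hFi hsum
  have h0 : ∀ n, ∫ ζ, F n ζ ∂m = 0 := fun n => by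
    simp only [hF]
    rw [integral_const_mul, integral_mul_pow_eq_zero hf, mul_zero]
  simp only [h0] at h1
  have h2 := h1.unique hasSum_zero
  have h3 : ∀ ζ : Circle, ∑' n, F n ζ
      = (starRingEnd ℂ) (herglotzRieszKernel 0 z ζ) * f ζ - f ζ := by
    intro ζ
    have hwζ : ‖w * ζ‖ < 1 := by rwa [norm_mul, Circle.norm_coe, mul_one]
    have hne : 1 - w * ζ ≠ 0 := by
      intro h
      rw [← sub_eq_zero.1 h, norm_one] at hwζ
      exact lt_irrefl _ hwζ
    have h4 : ∀ n, F n ζ = 2 * w * ζ * f ζ * (w * ζ) ^ n := fun n => by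
      simp only [hF, mul_pow]; ring
    simp only [h4]
    rw [tsum_mul_left, tsum_geometric_of_norm_lt_one hwζ]
    have hζ : (starRingEnd ℂ) (ζ : ℂ) = (ζ : ℂ)⁻¹ := by
      rw [← Circle.coe_inv_eq_conj, Circle.coe_inv]
    have hζ0 : (ζ : ℂ) ≠ 0 := Circle.coe_ne_zero ζ
    have h5 : (ζ : ℂ)⁻¹ - w = (ζ : ℂ)⁻¹ * (1 - w * ζ) := by
      field_simp
    simp only [herglotzRieszKernel_def, sub_zero, map_div₀, map_add, map_sub, ← hw]
    rw [hζ, h5]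
    field_simp
    ring
  have hK : Integrable
      (fun ζ : Circle => (starRingEnd ℂ) (herglotzRieszKernel 0 z ζ) * f ζ) m := by
    obtain ⟨C, hC⟩ :=
      (isCompact_range (continuous_herglotzRieszKernel hz)).isBounded.exists_norm_le
    exact hfi.bdd_mul
      (Complex.continuous_conj.comp (continuous_herglotzRieszKernel hz)).aestronglyMeasurable
      (ae_of_all _ fun ζ => by rw [RCLike.norm_conj]; exact hC _ ⟨ζ, rfl⟩)
  simp only [h3] at h2
  rw [integral_sub hK hfi] at h2
  exact sub_eq_zero.1 h2

/-- The Poisson integral of a function in `H²` is half the sum of its Herglotz integral and its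
mean, hence holomorphic. -/
theorem differentiableOn_poissonExtension {f : L2}
    (hf : ∀ n : ℤ, n < 0 → fourierCoefficient f n = 0) :
    DifferentiableOn ℂ (poissonExtension f) (Metric.ball 0 1) := by
  have hfi := integrable_coe_L2 f
  refine (((differentiableOn_herglotzIntegral hfi).add_const (∫ ζ, f ζ ∂m)).div_const 2).congr
    fun z hz => ?_
  have hz' : ‖z‖ < 1 := by simpa using hz
  have h1 : ∀ ζ : Circle, (starRingEnd ℂ) (herglotzRieszKernel 0 z ζ) * f ζ
      = 2 * ((poissonKernel 0 z ζ : ℂ) * f ζ) - herglotzRieszKernel 0 z ζ * f ζ := by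
    intro ζ
    rw [poissonKernel_eq_re_herglotzRieszKernel, Function.comp_apply, Complex.re_eq_add_conj]
    ring
  have h2 := integral_conj_herglotzRieszKernel_mul hf hz'
  simp only [h1] at h2
  rw [integral_sub ((integrable_ofReal_poissonKernel_mul hz' hfi).const_mul _)
    (integrable_herglotzRieszKernel_mul hz' hfi), integral_const_mul] at h2
  simp only [herglotzIntegral, poissonExtension]
  rw [eq_div_iff two_ne_zero, ← h2]
  ring

theorem eq_zero_of_poissonExtension_eq_zero {f : L2}
    (h : ∀ z : ℂ, ‖z‖ < 1 → poissonExtension f z = 0) : f = 0 := by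
  have hfi := integrable_coe_L2 f
  obtain ⟨r, hr, -, h1, -⟩ := exists_seq_tendsto_poissonIntegral hfi hfi
  refine (Lp.eq_zero_iff_ae_eq_zero).2 ?_
  filter_upwards [h1] with ξ hξ
  have h2 : ∀ k, poissonIntegral (fun ζ => f ζ) (r k * ξ) = 0 := fun k =>
    h _ (norm_ofReal_mul_coe_lt_one (hr k).1.le (hr k).2 ξ)
  simp only [h2] at hξ
  exact tendsto_nhds_unique hξ tendsto_const_nhds

/-- A two-constants estimate for `H²`: if `f` vanishes on `E`, multiplication by the outer
function of modulus `eⁿ` on `E` and `1` elsewhere leaves the boundary modulus of `f` unchanged. -/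
theorem norm_poissonExtension_mul_exp_le {f : L2}
    (hf : ∀ n : ℤ, n < 0 → fourierCoefficient f n = 0) {E : Set Circle} (hE : MeasurableSet E)
    (hfE : ∀ᵐ ζ ∂m, ζ ∈ E → f ζ = 0) {w : ℂ} (hw : ‖w‖ < 1) (n : ℕ) :
    ‖poissonExtension f w‖
        * Real.exp (n * ∫ ζ : Circle, poissonKernel 0 w ζ * E.indicator (fun _ => 1) ζ ∂m)
      ≤ ∫ ζ : Circle, poissonKernel 0 w ζ * ‖f ζ‖ ∂m := by
  have hfi := integrable_coe_L2 f
  set χ : Circle → ℝ := E.indicator (fun _ => 1) with hχ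
  have hχi : Integrable χ m := (integrable_const (1 : ℝ)).indicator hE
  set φ : Circle → ℝ := fun ζ => -((n : ℝ) * χ ζ) with hφ
  have hφi : Integrable φ m := (hχi.const_mul _).neg
  obtain ⟨G, hG, hGn⟩ := exists_holomorphic_norm_eq_exp_neg hφi
  have hGn' : ∀ z : ℂ, ‖z‖ < 1 →
      ‖G z‖ = Real.exp (n * ∫ ζ : Circle, poissonKernel 0 z ζ * χ ζ ∂m) := by
    intro z hz
    rw [hGn z hz, ← integral_neg, ← integral_const_mul]
    congr 2; ext ζ; simp only [hφ]; ring
  have hF := differentiableOn_poissonExtension hf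
  set F := poissonExtension f with hFdef
  obtain ⟨r, hr, hrlim, h1, h2⟩ := exists_seq_tendsto_poissonIntegral hfi (hχi.ofReal (𝕜 := ℂ))
  have hL1 := (tendsto_lintegral_enorm_poissonIntegral_sub hfi).comp hrlim
  have hreal : ∀ z : ℂ, poissonIntegral (fun ζ => ((χ ζ : ℝ) : ℂ)) z
        = ((∫ ζ : Circle, poissonKernel 0 z ζ * χ ζ ∂m : ℝ) : ℂ) := by
    intro z
    rw [poissonIntegral, ← integral_complex_ofReal]
    simp only [Complex.ofReal_mul]
  have hGle : ∀ z : ℂ, ‖z‖ < 1 → ‖G z‖ ≤ Real.exp n := by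
    intro z hz
    rw [hGn' z hz, Real.exp_le_exp]
    refine mul_le_of_le_one_right (Nat.cast_nonneg n) ?_
    rw [← integral_poissonKernel hz]
    refine integral_mono (integrable_poissonKernel_mul hz hχi)
      (integrable_poissonKernel hz) fun ζ => ?_
    refine mul_le_of_le_one_right (poissonKernel_pos hz ζ).le ?_
    exact Set.indicator_le_self' (fun _ _ => zero_le_one) ζ
  have hrw : ∀ (k : ℕ) (ζ : Circle), ‖(r k : ℂ) * ζ‖ < 1 := fun k ζ =>
    norm_ofReal_mul_coe_lt_one (hr k).1.le (hr k).2 ζ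
  have hFc : ∀ k, Continuous fun ζ : Circle => F (r k * ζ) := fun k =>
    continuous_coe_circle_dilate hF (hr k).1.le (hr k).2
  have hGc : ∀ k, Continuous fun ζ : Circle => G (r k * ζ) := fun k =>
    continuous_coe_circle_dilate hG (hr k).1.le (hr k).2
  have hdi : ∀ k, Integrable (fun ζ : Circle => ‖F (r k * ζ) - f ζ‖) m := fun k =>
    ((integrable_of_continuous (hFc k)).sub hfi).norm
  have hbi : ∀ k, Integrable (fun ζ : Circle => ‖f ζ‖ * ‖G (r k * ζ)‖) m := fun k =>
    hfi.norm.mul_bdd (c := Real.exp n) (hGc k).norm.aestronglyMeasurable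
      (ae_of_all _ fun ζ => by rw [norm_norm]; exact hGle _ (hrw k ζ))
  -- on the circle of radius `rₖ`, `|F G|` is at most `|F - f| eⁿ + |f| |G|`; the first term tends
  -- to `0` in `L¹`, the second converges by domination, `f` being zero on `E`
  have hA : Tendsto (fun k => ∫ ζ : Circle, poissonKernel 0 w ζ * ‖F (r k * ζ) - f ζ‖ ∂m) atTop
      (𝓝 0) := by
    have h3 : Tendsto (fun k => ∫ ζ : Circle, ‖F (r k * ζ) - f ζ‖ ∂m) atTop (𝓝 0) := by
      have h4 := (ENNReal.tendsto_toReal ENNReal.zero_ne_top).comp hL1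
      rw [ENNReal.toReal_zero] at h4
      refine h4.congr fun k => ?_
      exact (integral_norm_eq_lintegral_enorm
        ((integrable_of_continuous (hFc k)).sub hfi).aestronglyMeasurable).symm
    have h5 := h3.const_mul ((1 - ‖w‖ ^ 2) / (1 - ‖w‖) ^ 2)
    rw [mul_zero] at h5
    refine squeeze_zero (fun k => integral_nonneg fun ζ =>
      mul_nonneg (poissonKernel_pos hw ζ).le (norm_nonneg _)) (fun k => ?_) h5
    rw [← integral_const_mul]
    exact integral_mono (integrable_poissonKernel_mul hw (hdi k)) ((hdi k).const_mul _) fun ζ =>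
      mul_le_mul_of_nonneg_right (poissonKernel_le hw ζ) (norm_nonneg _)
  have hB : Tendsto (fun k => ∫ ζ : Circle, poissonKernel 0 w ζ * (‖f ζ‖ * ‖G (r k * ζ)‖) ∂m) atTop
      (𝓝 (∫ ζ : Circle, poissonKernel 0 w ζ * ‖f ζ‖ ∂m)) := by
    refine tendsto_integral_of_dominated_convergence
      (fun ζ => poissonKernel 0 w ζ * (‖f ζ‖ * Real.exp n))
      (fun k => (integrable_poissonKernel_mul hw (hbi k)).aestronglyMeasurable)
      (integrable_poissonKernel_mul hw (hfi.norm.mul_const _)) (fun k => ae_of_all _ fun ζ => ?_) ?_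
    · have hp := (poissonKernel_pos hw ζ).le
      rw [Real.norm_of_nonneg (by positivity)]
      gcongr
      exact hGle _ (hrw k ζ)
    · filter_upwards [h2, hfE] with ζ hζ hζE
      by_cases hmem : ζ ∈ E
      · simp [hζE hmem]
      · have h6 : Tendsto (fun k => ‖G (r k * ζ)‖) atTop (𝓝 1) := by
          have h7 : Tendsto (fun k => (poissonIntegral (fun ζ => ((χ ζ : ℝ) : ℂ)) (r k * ζ)).re)
              atTop (𝓝 0) := by
            have h0 : χ ζ = 0 := Set.indicator_of_notMem hmem _
            rw [h0] at hζ
            exact (Complex.continuous_re.tendsto _).comp hζ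
          have h8 := (Real.continuous_exp.tendsto _).comp (h7.const_mul (n : ℝ))
          rw [mul_zero, Real.exp_zero] at h8
          refine h8.congr fun k => ?_
          simp only [Function.comp_apply]
          rw [hGn' _ (hrw k ζ), hreal, Complex.ofReal_re]
        simpa using (h6.const_mul ‖f ζ‖).const_mul (poissonKernel 0 w ζ)
  have hlim : Tendsto (fun k => F (r k * w) * G (r k * w)) atTop (𝓝 (F w * G w)) := by
    have hc : ∀ {H : ℂ → ℂ}, DifferentiableOn ℂ H (Metric.ball 0 1) →
        Tendsto (fun k => H (r k * w)) atTop (𝓝 (H w)) := by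
      intro H hH
      have h3 : Tendsto (fun k => (r k : ℂ) * w) atTop (𝓝 w) := by
        simpa using ((Complex.continuous_ofReal.tendsto _).comp
          (tendsto_nhds_of_tendsto_nhdsWithin hrlim)).mul_const w
      exact (hH.continuousOn.continuousAt
        (Metric.isOpen_ball.mem_nhds (by simpa using hw))).tendsto.comp h3
    exact (hc hF).mul (hc hG)
  have hABlim := (hA.mul_const (Real.exp n)).add hB
  rw [zero_mul, zero_add] at hABlim
  rw [← hGn' w hw, ← norm_mul]
  refine le_of_tendsto_of_tendsto' hlim.norm hABlim fun k => ?_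
  have hFG : DiffContOnCl ℂ (fun z => F (r k * z) * G (r k * z)) (Metric.ball 0 1) :=
    (diffContOnCl_dilate hF (hr k).1.le (hr k).2).smul
      (diffContOnCl_dilate hG (hr k).1.le (hr k).2)
  rw [← integral_poissonKernel_mul hFG hw]
  have hFGi : Integrable (fun ζ : Circle => F (r k * ζ) * G (r k * ζ)) m :=
    integrable_of_continuous ((hFc k).mul (hGc k))
  refine (norm_poissonIntegral_le hw).trans ?_
  rw [← integral_mul_const, ← integral_add
    ((integrable_poissonKernel_mul hw (hdi k)).mul_const _)
    (integrable_poissonKernel_mul hw (hbi k))]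
  refine integral_mono (integrable_poissonKernel_mul hw hFGi.norm)
    (((integrable_poissonKernel_mul hw (hdi k)).mul_const _).add
      (integrable_poissonKernel_mul hw (hbi k))) fun ζ => ?_
  have hp := (poissonKernel_pos hw ζ).le
  have h9 : ‖F (r k * ζ)‖ ≤ ‖F (r k * ζ) - f ζ‖ + ‖f ζ‖ := by
    simpa using norm_add_le (F (r k * ζ) - f ζ) (f ζ)
  have h10 : ‖F (r k * ζ) * G (r k * ζ)‖
      ≤ ‖F (r k * ζ) - f ζ‖ * Real.exp n + ‖f ζ‖ * ‖G (r k * ζ)‖ := by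
    rw [norm_mul]
    calc _ ≤ (‖F (r k * ζ) - f ζ‖ + ‖f ζ‖) * ‖G (r k * ζ)‖ := by gcongr
      _ = ‖F (r k * ζ) - f ζ‖ * ‖G (r k * ζ)‖ + ‖f ζ‖ * ‖G (r k * ζ)‖ := by ring
      _ ≤ _ := by
        gcongr
        exact hGle _ (hrw k ζ)
  simp only
  calc _ ≤ poissonKernel 0 w ζ *
        (‖F (r k * ζ) - f ζ‖ * Real.exp n + ‖f ζ‖ * ‖G (r k * ζ)‖) := by gcongr
    _ = _ := by ring

/-- The uniqueness theorem for `H²`: a function vanishing on a set of positive measure is zero. -/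
theorem eq_zero_of_ae_eq_zero_on {f : L2} (hf : ∀ n : ℤ, n < 0 → fourierCoefficient f n = 0)
    {E : Set Circle} (hE : MeasurableSet E) (hE0 : m E ≠ 0)
    (hfE : ∀ᵐ ζ ∂m, ζ ∈ E → f ζ = 0) : f = 0 := by
  refine eq_zero_of_poissonExtension_eq_zero fun w hw => ?_
  set A := ∫ ζ : Circle, poissonKernel 0 w ζ * E.indicator (fun _ => 1) ζ ∂m with hA
  have hχi : Integrable (E.indicator (fun _ => (1 : ℝ))) m :=
    (integrable_const (1 : ℝ)).indicator hE
  have hApos : 0 < A := by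
    rw [hA, integral_pos_iff_support_of_nonneg
      (fun ζ => mul_nonneg (poissonKernel_pos hw ζ).le
        (Set.indicator_nonneg (fun _ _ => zero_le_one) ζ))
      (integrable_poissonKernel_mul hw hχi)]
    refine pos_iff_ne_zero.2 fun h => hE0 (measure_mono_null (fun ζ hζ => ?_) h)
    simp [hζ, (poissonKernel_pos hw ζ).ne']
  by_contra hne
  have hlim : Tendsto (fun n : ℕ => ‖poissonExtension f w‖ * Real.exp (n * A)) atTop atTop :=
    (Real.tendsto_exp_atTop.comp
      (tendsto_natCast_atTop_atTop.atTop_mul_const hApos)).const_mul_atTop (norm_pos_iff.2 hne)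
  obtain ⟨n, hn⟩ := (hlim.eventually_gt_atTop
    (∫ ζ : Circle, poissonKernel 0 w ζ * ‖f ζ‖ ∂m)).exists
  exact absurd (norm_poissonExtension_mul_exp_le hf hE hfE hw n) (not_le.2 hn)

/-! ### Capacity and nontangential limits -/

theorem lintegral_enorm_sq_L2 (f : L2) : ∫⁻ ζ, ‖f ζ‖ₑ ^ 2 ∂m = ENNReal.ofReal (‖f‖ ^ 2) := by
  have h := eLpNorm_nnreal_pow_eq_lintegral (f := f) (μ := m) (p := 2) two_ne_zero
  simp only [NNReal.coe_ofNat, ENNReal.coe_ofNat, ENNReal.rpow_ofNat] at h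
  rw [← h, Lp.norm_def, ENNReal.ofReal_pow ENNReal.toReal_nonneg,
    ENNReal.ofReal_toReal (Lp.eLpNorm_ne_top f)]

/-- Capacity dominates normalized arc length. -/
theorem measure_le_capacity (μ : Measure Circle) (A : Set Circle) : m A ≤ capacity μ A := by
  refine le_iInf₂ fun f hf => ?_
  obtain ⟨-, U, hU, hAU, hfU⟩ := hf
  calc m A ≤ m U := measure_mono hAU
    _ = ∫⁻ ζ, U.indicator 1 ζ ∂m := (lintegral_indicator_one hU.measurableSet).symm
    _ ≤ ∫⁻ ζ, ‖f ζ‖ₑ ^ 2 ∂m := by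
        refine lintegral_mono_ae ?_
        filter_upwards [hfU] with ζ hζ
        refine Set.indicator_apply_le' (fun hmem => ?_) fun _ => zero_le
        have h1 : (1 : ℝ≥0∞) ≤ ‖f ζ‖ₑ := by
          rw [← ofReal_norm, ← ENNReal.ofReal_one]
          exact ENNReal.ofReal_le_ofReal (hζ hmem)
        exact one_le_pow₀ h1
    _ = ENNReal.ofReal (‖f‖ ^ 2) := lintegral_enorm_sq_L2 f
    _ ≤ normSq μ f := le_self_add

theorem capacity_empty (μ : Measure Circle) : capacity μ ∅ = 0 := by
  have hloc : ∀ ξ, localDirichletIntegral 0 ξ = 0 := by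
    intro ξ
    have hnt : HasNTLimit 0 ξ 0 := fun α _ => by
      refine tendsto_const_nhds.congr fun z => (poissonExtension_zero z).symm
    refine le_antisymm ((iInf₂_le 0 hnt).trans_eq ?_) zero_le
    rw [← lintegral_zero (μ := m)]
    refine lintegral_congr_ae ?_
    filter_upwards [Lp.coeFn_zero ℂ 2 m] with ζ hζ
    rw [hζ]; simp
  have hD : dirichletIntegral μ 0 = 0 := by simp [dirichletIntegral, hloc]
  refine le_antisymm ((iInf₂_le (0 : L2) ⟨?_, ∅, isOpen_empty, subset_rfl, by simp⟩).trans_eq ?_)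
    zero_le
  · rw [normSq, hD, norm_zero]; simp
  · exact hD.trans_lt ENNReal.zero_lt_top

theorem tendsto_radial (ξ : Circle) {r : ℕ → ℝ} (hr : ∀ k, 0 < r k ∧ r k < 1)
    (hrlim : Tendsto r atTop (𝓝[<] 1)) {α : ℝ} (hα : 1 < α) :
    Tendsto (fun k => (r k : ℂ) * ξ) atTop (𝓝[approachRegion α ξ] (ξ : ℂ)) := by
  refine tendsto_nhdsWithin_iff.2 ⟨?_, Eventually.of_forall fun k => ?_⟩
  · simpa using ((Complex.continuous_ofReal.tendsto _).comp
      (tendsto_nhds_of_tendsto_nhdsWithin hrlim)).mul_const (ξ : ℂ)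
  · have h1 : (r k : ℂ) * ξ - ξ = ((r k - 1 : ℝ) : ℂ) * ξ := by push_cast; ring
    refine ⟨norm_ofReal_mul_coe_lt_one (hr k).1.le (hr k).2 ξ, ?_⟩
    rw [h1, norm_mul, norm_mul, Circle.norm_coe, Complex.norm_real, Complex.norm_real,
      Real.norm_of_nonneg (hr k).1.le, Real.norm_of_nonpos (by linarith [(hr k).2])]
    nlinarith [hr k]

/-- Where the nontangential limit is `0`, so is the function, almost everywhere: the radial Poisson
integrals converge almost everywhere to the function along some sequence of radii. -/
theorem ae_eq_zero_of_hasNTLimit (f : L2) : ∀ᵐ ξ ∂m, HasNTLimit f ξ 0 → f ξ = 0 := by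
  have hfi := integrable_coe_L2 f
  obtain ⟨r, hr, hrlim, h1, -⟩ := exists_seq_tendsto_poissonIntegral hfi hfi
  filter_upwards [h1] with ξ hξ hnt
  exact tendsto_nhds_unique hξ ((hnt 2 one_lt_two).comp (tendsto_radial ξ hr hrlim one_lt_two))

theorem isUniquenessSet_of_measure_ne_zero (μ : Measure Circle) {E : Set Circle}
    (hE : MeasurableSet E) (hE0 : m E ≠ 0) : IsUniquenessSet μ E := by
  intro f hf hq
  refine eq_zero_of_ae_eq_zero_on hf.2 hE hE0 ?_
  have h1 : m {ξ | ξ ∈ E ∧ ¬ HasNTLimit f ξ 0} = 0 :=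
    le_antisymm ((measure_le_capacity μ _).trans_eq hq) zero_le
  filter_upwards [ae_eq_zero_of_hasNTLimit f, measure_eq_zero_iff_ae_notMem.1 h1] with ξ hξ hξ' hmem
  refine hξ ?_
  by_contra hc
  exact hξ' ⟨hmem, hc⟩

/-- If `h` is dominated by `ε + C |ζ - ξ|²` for every `ε > 0`, then the Poisson integral of `h`, and
with it the Poisson integral of `f`, tends to `0` at `ξ`. -/
theorem hasNTLimit_zero_of_bound {f : L2} {h : Circle → ℝ} (hi : Integrable h m)
    (hf : ∀ z : ℂ, ‖z‖ < 1 → ‖poissonExtension f z‖ ^ 2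
      ≤ ∫ ζ : Circle, poissonKernel 0 z ζ * h ζ ∂m) {ξ : Circle}
    (hb : ∀ ε : ℝ, 0 < ε → ∃ C : ℝ, ∀ᵐ ζ : Circle ∂m, h ζ ≤ ε + C * ‖(ζ : ℂ) - ξ‖ ^ 2) :
    HasNTLimit f ξ 0 := by
  intro α _
  have hsq : Tendsto (fun z => ‖poissonExtension f z‖ ^ 2) (𝓝[approachRegion α ξ] (ξ : ℂ))
      (𝓝 0) := by
    refine tendsto_order.2 ⟨fun a ha => Eventually.of_forall fun z => ha.trans_le (by positivity),
      fun a ha => ?_⟩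
    obtain ⟨C, hC⟩ := hb (a / 2) (by positivity)
    have hlim : Tendsto (fun z : ℂ => a / 2 + C * (2 - 2 * (z * (starRingEnd ℂ) ξ).re))
        (𝓝[approachRegion α ξ] (ξ : ℂ)) (𝓝 (a / 2)) := by
      have hc : Continuous fun z : ℂ =>
        a / 2 + C * (2 - 2 * (z * (starRingEnd ℂ) (ξ : ℂ)).re) := by fun_prop
      have h1 := hc.tendsto (ξ : ℂ)
      rw [Complex.mul_conj, Circle.normSq_coe] at h1
      simp only [Complex.ofReal_one, Complex.one_re, mul_one, sub_self, mul_zero, add_zero] at h1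
      exact h1.mono_left nhdsWithin_le_nhds
    filter_upwards [hlim.eventually_lt_const (by linarith : a / 2 < a), self_mem_nhdsWithin]
      with z hz hzm
    refine lt_of_le_of_lt ?_ hz
    rw [← integral_poissonKernel_mul_quadratic hzm.1]
    refine (hf z hzm.1).trans (integral_mono_ae (integrable_poissonKernel_mul hzm.1 hi)
      (integrable_poissonKernel_mul hzm.1 (integrable_of_continuous (by fun_prop))) ?_)
    filter_upwards [hC] with ζ hζ
    exact mul_le_mul_of_nonneg_left hζ (poissonKernel_pos hzm.1 ζ).le
  have h2 := (Real.continuous_sqrt.tendsto 0).comp hsq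
  rw [Real.sqrt_zero] at h2
  refine tendsto_zero_iff_norm_tendsto_zero.2 (h2.congr fun z => ?_)
  exact Real.sqrt_sq (norm_nonneg _)

/-! ### Potentials of discrete measures -/

theorem lintegral_discreteMeasure (a : ℕ → ℝ) (z : ℕ → Circle) (g : Circle → ℝ≥0∞) :
    ∫⁻ ξ, g ξ ∂(discreteMeasure a z) = ∑' n, ENNReal.ofReal (a n) * g (z n) := by
  rw [discreteMeasure, lintegral_sum_measure]
  simp only [lintegral_smul_measure, lintegral_dirac, smul_eq_mul]

theorem newtonianPotential_discreteMeasure (a : ℕ → ℝ) (z : ℕ → Circle) (ζ : Circle) :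
    newtonianPotential (discreteMeasure a z) ζ
      = ∑' n, ENNReal.ofReal (a n) * (ENNReal.ofReal (‖(z n : ℂ) - (ζ : ℂ)‖ ^ 2))⁻¹ :=
  lintegral_discreteMeasure a z _

theorem measurable_newtonianPotential_discreteMeasure (a : ℕ → ℝ) (z : ℕ → Circle) :
    Measurable (newtonianPotential (discreteMeasure a z)) := by
  have h : newtonianPotential (discreteMeasure a z) = fun ζ : Circle =>
      ∑' n, ENNReal.ofReal (a n) * (ENNReal.ofReal (‖(z n : ℂ) - (ζ : ℂ)‖ ^ 2))⁻¹ :=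
    funext (newtonianPotential_discreteMeasure a z)
  rw [h]
  refine Measurable.tsum fun n => ?_
  have hc : Continuous fun ζ : Circle => ‖(z n : ℂ) - (ζ : ℂ)‖ ^ 2 := by fun_prop
  exact (hc.measurable.ennreal_ofReal.inv).const_mul _

theorem inv_four_le_newtonianPotential {a : ℕ → ℝ} (ha : ∀ n, 0 < a n) (hsum : HasSum a 1)
    (z : ℕ → Circle) (ζ : Circle) :
    4⁻¹ ≤ newtonianPotential (discreteMeasure a z) ζ := by
  have h1 : ∑' n, ENNReal.ofReal (a n) = 1 := by
    rw [← ENNReal.ofReal_tsum_of_nonneg (fun n => (ha n).le) hsum.summable, hsum.tsum_eq,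
      ENNReal.ofReal_one]
  rw [newtonianPotential_discreteMeasure]
  calc (4⁻¹ : ℝ≥0∞) = ∑' n, ENNReal.ofReal (a n) * 4⁻¹ := by
        rw [ENNReal.tsum_mul_right, h1, one_mul]
    _ ≤ _ := by
      refine ENNReal.tsum_le_tsum fun n => ?_
      gcongr
      have h2 : ‖(z n : ℂ) - ζ‖ ≤ 2 := by
        have := norm_sub_le (z n : ℂ) ζ
        rw [Circle.norm_coe, Circle.norm_coe] at this
        linarith
      have h3 : ‖(z n : ℂ) - ζ‖ ^ 2 ≤ 4 := by nlinarith [norm_nonneg ((z n : ℂ) - ζ)]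
      simpa using ENNReal.ofReal_le_ofReal h3

theorem ofReal_le_newtonianPotential_mul (a : ℕ → ℝ) (z : ℕ → Circle) (n : ℕ) {ζ : Circle}
    (hζ : newtonianPotential (discreteMeasure a z) ζ ≠ ∞) :
    ENNReal.ofReal (a n)
      ≤ newtonianPotential (discreteMeasure a z) ζ * ENNReal.ofReal (‖(ζ : ℂ) - z n‖ ^ 2) := by
  have h := ENNReal.le_tsum (f := fun n =>
    ENNReal.ofReal (a n) * (ENNReal.ofReal (‖(z n : ℂ) - (ζ : ℂ)‖ ^ 2))⁻¹) n
  rw [← newtonianPotential_discreteMeasure, ← div_eq_mul_inv,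
    ENNReal.div_le_iff_le_mul (Or.inr hζ) (Or.inl ENNReal.ofReal_ne_top)] at h
  rwa [norm_sub_rev]

/-- The positive part of the integral is finite, since the negative part is. -/
theorem lintegral_log_toENNReal_ne_top {V : Circle → ℝ≥0∞} (hV : ∀ ζ, 4⁻¹ ≤ V ζ)
    (hfin : extendedIntegral arcLength (fun ζ => ENNReal.log (V ζ)) < ⊤) :
    ∫⁻ ζ, (ENNReal.log (V ζ)).toENNReal ∂m ≠ ∞ := by
  have hneg : ∫⁻ ζ, (-ENNReal.log (V ζ)).toENNReal ∂arcLength ≠ ∞ := by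
    have hle : ∀ ζ, (-ENNReal.log (V ζ)).toENNReal ≤ (ENNReal.log 4).toENNReal := by
      intro ζ
      refine EReal.toENNReal_le_toENNReal ?_
      rw [← ENNReal.log_inv]
      exact ENNReal.log_monotone (ENNReal.inv_le_iff_inv_le.1 (hV ζ))
    refine ne_top_of_le_ne_top ?_ (lintegral_mono hle)
    rw [lintegral_const]
    refine ENNReal.mul_ne_top ?_ (measure_ne_top _ _)
    simp
  have hpos : ∫⁻ ζ, (ENNReal.log (V ζ)).toENNReal ∂arcLength ≠ ∞ := by
    intro h
    rw [extendedIntegral, h, EReal.coe_ennreal_top, EReal.top_sub] at hfin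
    · exact lt_irrefl _ hfin
    · simpa using hneg
  rw [m, lintegral_smul_measure]
  exact ENNReal.mul_ne_top ENNReal.ofReal_ne_top hpos

theorem log_four_mul_toReal_nonneg {V : ℝ≥0∞} (hV : 4⁻¹ ≤ V) : 0 ≤ Real.log (4 * V.toReal) := by
  rcases eq_or_ne V ∞ with rfl | h
  · simp
  · refine Real.log_nonneg ?_
    have := ENNReal.toReal_mono h hV
    simp only [ENNReal.toReal_inv, ENNReal.toReal_ofNat] at this
    linarith

theorem toReal_pos_of_inv_four_le {V : ℝ≥0∞} (hV : 4⁻¹ ≤ V) (h : V ≠ ∞) : 0 < V.toReal := by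
  refine ENNReal.toReal_pos (fun h0 => ?_) h
  rw [h0] at hV
  simp at hV

theorem integrable_log_four_mul_toReal {V : Circle → ℝ≥0∞} (hVm : Measurable V)
    (hV : ∀ ζ, 4⁻¹ ≤ V ζ) (hfin : ∫⁻ ζ, (ENNReal.log (V ζ)).toENNReal ∂m ≠ ∞) :
    Integrable (fun ζ => Real.log (4 * (V ζ).toReal)) m ∧ ∀ᵐ ζ ∂m, V ζ ≠ ∞ := by
  have hlm : Measurable fun ζ => (ENNReal.log (V ζ)).toENNReal :=
    (ENNReal.measurable_log.comp hVm).ereal_toENNReal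
  have hae : ∀ᵐ ζ ∂m, V ζ ≠ ∞ := by
    filter_upwards [ae_lt_top hlm hfin] with ζ hζ h
    simp [h] at hζ
  refine ⟨?_, hae⟩
  refine Integrable.mono' ((integrable_const (Real.log 4)).add
    (integrable_toReal_of_lintegral_ne_top hlm.aemeasurable hfin))
    (Measurable.aestronglyMeasurable (by fun_prop)) ?_
  filter_upwards [hae] with ζ hζ
  have hpos := toReal_pos_of_inv_four_le (hV ζ) hζ
  rw [Real.norm_of_nonneg (log_four_mul_toReal_nonneg (hV ζ)),
    Real.log_mul (by norm_num) hpos.ne', Pi.add_apply, ENNReal.log_pos_real' hpos]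
  refine add_le_add_right ?_ _
  rw [EReal.toENNReal_of_ne_top (by simp), EReal.toReal_coe, ENNReal.toReal_ofReal']
  exact le_max_left _ _

/-- A null set has a sequence of open neighborhoods whose counting function is integrable. -/
theorem exists_isOpen_superset_lintegral_ne_top {E : Set Circle} (hE : m E = 0) :
    ∃ U : ℕ → Set Circle, (∀ k, IsOpen (U k)) ∧ (∀ k, E ⊆ U k) ∧
      Measurable (fun ζ => ∑' k, (U k).indicator (fun _ => (1 : ℝ≥0∞)) ζ) ∧
      ∫⁻ ζ, ∑' k, (U k).indicator (fun _ => (1 : ℝ≥0∞)) ζ ∂m ≠ ∞ := by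
  obtain ⟨ε, hε, hεs⟩ := ENNReal.exists_pos_sum_of_countable' one_ne_zero ℕ
  have hU : ∀ k, ∃ U, U ⊇ E ∧ IsOpen U ∧ m U ≤ ε k := fun k => by
    obtain ⟨U, h1, h2, h3⟩ := E.exists_isOpen_le_add m (hε k).ne'
    exact ⟨U, h1, h2, by rwa [hE, zero_add] at h3⟩
  choose U hEU hUo hUm using hU
  have hmeas : ∀ k, Measurable ((U k).indicator (fun _ => (1 : ℝ≥0∞))) := fun k =>
    measurable_const.indicator (hUo k).measurableSet
  refine ⟨U, hUo, hEU, Measurable.tsum hmeas, ?_⟩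
  rw [lintegral_tsum fun k => (hmeas k).aemeasurable]
  simp only [lintegral_indicator_const (hUo _).measurableSet, one_mul]
  exact ne_top_of_le_ne_top (hεs.trans ENNReal.one_lt_top).ne (ENNReal.tsum_le_tsum hUm)

/-- The weighted Dirichlet integral is dominated by `∫ |f|² V₂(μ)` if the boundary values of `f`
vanish at all the atoms of `μ`. -/
theorem dirichletIntegral_discreteMeasure_le (a : ℕ → ℝ) (z : ℕ → Circle) {f : L2}
    (hf : ∀ n, HasNTLimit f (z n) 0) :
    dirichletIntegral (discreteMeasure a z) f
      ≤ ∫⁻ ζ, newtonianPotential (discreteMeasure a z) ζ * ENNReal.ofReal (‖f ζ‖ ^ 2) ∂m := by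
  have hfm : AEMeasurable (fun ζ => ENNReal.ofReal (‖f ζ‖ ^ 2)) m :=
    ((Lp.aestronglyMeasurable f).norm.aemeasurable.pow_const 2).ennreal_ofReal
  rw [dirichletIntegral, lintegral_discreteMeasure]
  simp only [newtonianPotential_discreteMeasure, ← ENNReal.tsum_mul_right]
  rw [lintegral_tsum fun n => ?_]
  · refine ENNReal.tsum_le_tsum fun n => ?_
    simp only [mul_assoc]
    rw [lintegral_const_mul' _ _ ENNReal.ofReal_ne_top]
    gcongr
    refine (iInf₂_le 0 (hf n)).trans (lintegral_mono fun ζ => ?_)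
    rw [sub_zero, norm_div, div_pow, norm_sub_rev]
    rcases eq_or_ne (‖(z n : ℂ) - ζ‖ ^ 2) 0 with h | h
    · simp [h]
    · rw [ENNReal.ofReal_div_of_pos (lt_of_le_of_ne (by positivity) h.symm), div_eq_mul_inv,
        mul_comm]
  · have hc : Continuous fun ζ : Circle => ‖(z n : ℂ) - (ζ : ℂ)‖ ^ 2 := by fun_prop
    exact ((hc.measurable.ennreal_ofReal.inv).const_mul _).aemeasurable.mul hfm

/-- The boundary modulus of the outer function is `(4 V₂)^(-1/2)`, which makes the Dirichlet
integral finite, times a factor that forces the limit `0` on `E`. -/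
theorem not_isUniquenessSet_of_measure_eq_zero {a : ℕ → ℝ} (ha : ∀ n, 0 < a n)
    (hsum : HasSum a 1) (z : ℕ → Circle)
    (hV : extendedIntegral arcLength
      (fun ζ => ENNReal.log (newtonianPotential (discreteMeasure a z) ζ)) < ⊤)
    {E : Set Circle} (hE : m E = 0) : ¬ IsUniquenessSet (discreteMeasure a z) E := by
  set V := newtonianPotential (discreteMeasure a z) with hVdef
  have hV4 : ∀ ζ, 4⁻¹ ≤ V ζ := inv_four_le_newtonianPotential ha hsum z
  obtain ⟨hWi, hVfin⟩ := integrable_log_four_mul_toReal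
    (measurable_newtonianPotential_discreteMeasure a z) hV4
    (lintegral_log_toENNReal_ne_top hV4 hV)
  obtain ⟨U, hUo, hEU, hNm, hNi⟩ := exists_isOpen_superset_lintegral_ne_top hE
  set N : Circle → ℝ≥0∞ := fun ζ => ∑' k, (U k).indicator (fun _ => (1 : ℝ≥0∞)) ζ with hN
  set ψ : Circle → ℝ := fun ζ => Real.log (4 * (V ζ).toReal) + (N ζ).toReal with hψ
  have hψi : Integrable ψ m :=
    hWi.add (integrable_toReal_of_lintegral_ne_top hNm.aemeasurable hNi)
  have hW0 : ∀ ζ, 0 ≤ Real.log (4 * (V ζ).toReal) := fun ζ => log_four_mul_toReal_nonneg (hV4 ζ)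
  have hψ0 : ∀ ζ, 0 ≤ ψ ζ := fun ζ => add_nonneg (hW0 ζ) ENNReal.toReal_nonneg
  obtain ⟨f, hf0, hfc, hfP, hfψ⟩ := exists_outer hψi hψ0
  have hei := integrable_exp_neg hψi hψ0
  have hexpV : ∀ ζ, V ζ ≠ ∞ → Real.exp (-ψ ζ) ≤ (4 * (V ζ).toReal)⁻¹ := by
    intro ζ hζ
    have hpos := toReal_pos_of_inv_four_le (hV4 ζ) hζ
    calc Real.exp (-ψ ζ) ≤ Real.exp (-Real.log (4 * (V ζ).toReal)) := by
          rw [Real.exp_le_exp]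
          have : 0 ≤ (N ζ).toReal := ENNReal.toReal_nonneg
          simp only [hψ]; linarith
      _ = (4 * (V ζ).toReal)⁻¹ := by rw [Real.exp_neg, Real.exp_log (by positivity)]
  -- at an atom, `V ≥ aₙ |ζ - zₙ|⁻²`
  have hatom : ∀ n, HasNTLimit f (z n) 0 := by
    intro n
    refine hasNTLimit_zero_of_bound hei hfP fun ε hε => ⟨(4 * a n)⁻¹, ?_⟩
    filter_upwards [hVfin] with ζ hζ
    have hpos := toReal_pos_of_inv_four_le (hV4 ζ) hζ
    have h1 := ENNReal.toReal_mono (ENNReal.mul_ne_top hζ ENNReal.ofReal_ne_top)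
      (ofReal_le_newtonianPotential_mul a z n hζ)
    rw [ENNReal.toReal_mul, ENNReal.toReal_ofReal (ha n).le,
      ENNReal.toReal_ofReal (by positivity)] at h1
    have h2 : (4 * (V ζ).toReal)⁻¹ ≤ (4 * a n)⁻¹ * ‖(ζ : ℂ) - z n‖ ^ 2 := by
      have := ha n
      rw [inv_mul_eq_div, le_div_iff₀ (by positivity), inv_mul_eq_div, div_le_iff₀ (by positivity)]
      linarith
    linarith [hexpV ζ hζ]
  have hmem : f ∈ dirichletSpace (discreteMeasure a z) := by
    refine ⟨(dirichletIntegral_discreteMeasure_le a z hatom).trans_lt ?_, hfc⟩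
    refine lt_of_le_of_lt (lintegral_mono_ae (g := fun _ => 1) ?_) (by simp)
    filter_upwards [hVfin, hfψ] with ζ hζ hfζ
    have hpos := toReal_pos_of_inv_four_le (hV4 ζ) hζ
    change V ζ * ENNReal.ofReal (‖f ζ‖ ^ 2) ≤ 1
    have hζV : V ζ ≠ ∞ := hζ
    rw [← ENNReal.ofReal_toReal hζV, ← ENNReal.ofReal_mul hpos.le, ENNReal.ofReal_le_one]
    calc (V ζ).toReal * ‖f ζ‖ ^ 2 ≤ (V ζ).toReal * (4 * (V ζ).toReal)⁻¹ := by
          gcongr; exact hfζ.trans (hexpV ζ hζ)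
      _ ≤ 1 := by field_simp; norm_num
  -- near a point of `E`, the counting function is as large as desired
  have hzero : ∀ ξ ∈ E, HasNTLimit f ξ 0 := by
    intro ξ hξ
    refine hasNTLimit_zero_of_bound hei hfP fun ε hε => ?_
    obtain ⟨K, hK⟩ := ((Real.tendsto_exp_neg_atTop_nhds_zero.comp
      tendsto_natCast_atTop_atTop).eventually_lt_const hε).exists
    have hopen : IsOpen (⋂ k ∈ Finset.range K, U k) :=
      isOpen_biInter_finset fun k _ => hUo k
    obtain ⟨δ, hδ, hball⟩ := Metric.isOpen_iff.1 hopen ξ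
      (Set.mem_iInter₂.2 fun k _ => hEU k hξ)
    refine ⟨(δ ^ 2)⁻¹, ?_⟩
    filter_upwards [ae_lt_top hNm hNi] with ζ hζ
    by_cases hd : dist ζ ξ < δ
    · have hin : ∀ k ∈ Finset.range K, ζ ∈ U k := Set.mem_iInter₂.1 (hball hd)
      have h1 : (K : ℝ≥0∞) ≤ N ζ := by
        refine le_trans ?_ (ENNReal.sum_le_tsum (Finset.range K))
        rw [Finset.sum_congr rfl fun k hk => Set.indicator_of_mem (hin k hk) _]
        simp
      have h2 : (K : ℝ) ≤ (N ζ).toReal := by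
        simpa using ENNReal.toReal_mono hζ.ne h1
      have h3 : Real.exp (-ψ ζ) ≤ Real.exp (-K) := by
        rw [Real.exp_le_exp]
        have := hW0 ζ
        simp only [hψ]; linarith
      have h4 : 0 ≤ (δ ^ 2)⁻¹ * ‖(ζ : ℂ) - ξ‖ ^ 2 := by positivity
      simp only [Function.comp_apply] at hK
      linarith
    · have h1 : δ ≤ ‖(ζ : ℂ) - ξ‖ := by
        rw [← dist_eq_norm]; exact not_lt.1 hd
      have h2 : 1 ≤ (δ ^ 2)⁻¹ * ‖(ζ : ℂ) - ξ‖ ^ 2 := by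
        rw [inv_mul_eq_div, one_le_div (by positivity)]
        gcongr
      have h3 : Real.exp (-ψ ζ) ≤ 1 := by
        rw [Real.exp_le_one_iff]; linarith [hψ0 ζ]
      linarith
  intro huniq
  refine hf0 (huniq f hmem ?_)
  have hempty : {ξ | ξ ∈ E ∧ ¬ HasNTLimit f ξ 0} = ∅ :=
    Set.eq_empty_iff_forall_notMem.2 fun ξ hξ => hξ.2 (hzero ξ hξ.1)
  rw [QuasiEverywhereOn, hempty, capacity_empty]

end WeightedDirichlet
end

/- Since `|ξ - ζ| ≤ 2`, the potential of a probability measure is at least `1/4`; so the negative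
part of its logarithm has a finite integral, and the integral in the hypothesis always makes sense
as an element of `(-∞, ∞]`. -/
theorem proposition3p2 (a : ℕ → ℝ) (ha : ∀ n, 0 < a n) (hsum : HasSum a 1) (z : ℕ → Circle)
    (hV : WeightedDirichlet.extendedIntegral WeightedDirichlet.arcLength
      (fun ζ => ENNReal.log
        (WeightedDirichlet.newtonianPotential (WeightedDirichlet.discreteMeasure a z) ζ)) < ⊤)
    (E : Set Circle) (hE : MeasurableSet E) :
    WeightedDirichlet.IsUniquenessSet (WeightedDirichlet.discreteMeasure a z) E ↔
      0 < WeightedDirichlet.arcLength E := by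
  rw [pos_iff_ne_zero, Ne, ← WeightedDirichlet.m_eq_zero_iff]
  exact ⟨fun h hE0 =>
      WeightedDirichlet.not_isUniquenessSet_of_measure_eq_zero ha hsum z hV hE0 h,
    WeightedDirichlet.isUniquenessSet_of_measure_ne_zero _ hE⟩
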